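/- Let $n\ge 1$ be an integer and let $0<\alpha<(n+1)/2$. Let $S^{2n+1}=\{\zeta\in\mathbb C^{n+1}:\sum_j|\zeta_j|^2=1\}$ with its (non-normalized) surface measure $d\zeta$, and write $\zeta\cdot\overline\eta=\sum_{j=1}^{n+1}\zeta_j\overline{\eta_j}$. Let $f:S^{2n+1}\to\mathbb C$ be any measurable function for which the double integral $$B[f]=\iint_{S^{2n+1}\times S^{2n+1}}\frac{\overline{f(\zeta)}\,f(\eta)}{|1-\zeta\cdot\overline\eta|^{2\alpha}}\,d\zeta\,d\eta$$ converges absolutely. Then $$A[f]=\iint_{S^{2n+1}\times S^{2n+1}}\frac{\overline{f(\zeta)}\,(\zeta\cdot\overline\eta+\overline\zeta\cdot\eta)\,f(\eta)}{|1-\zeta\cdot\overline\eta|^{2\alpha}}\,d\zeta\,d\eta$$ also converges absolutely, $A[f]$ and $B[f]$ are real, and $$A[f]\ \ge\ \frac{2\alpha}{n+1-\alpha}\,B[f],$$ with equality if and only if $f$ is constant almost everywhere. -/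

import Mathlib

open MeasureTheory

noncomputable section

/-- The complex vector space `ℂ^{n+1}` with its Hermitian (Euclidean) norm. -/
abbrev CSpace (n : ℕ) : Type := EuclideanSpace ℂ (Fin (n + 1))

/-- The unit sphere `S^{2n+1}` of `ℂ^{n+1}`. -/
abbrev CSphere (n : ℕ) : Type := Metric.sphere (0 : CSpace n) 1

/-- The (non-normalized) surface measure on `S^{2n+1}`, induced by Lebesgue measure on
`ℂ^{n+1} = ℝ^{2n+2}` through polar coordinates. -/
def sphereMeasure (n : ℕ) : Measure (CSphere n) :=
  (volume : Measure (CSpace n)).toSphere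

/-- `ζ · η̄ = ∑ j, ζ_j * conj η_j`. -/
def hdot {n : ℕ} (ζ η : CSphere n) : ℂ :=
  ∑ j, (ζ : CSpace n) j * star ((η : CSpace n) j)

/-- The kernel `|1 - ζ · η̄|^{-2α}`. -/
def rieszKernel {n : ℕ} (α : ℝ) (ζ η : CSphere n) : ℝ :=
  ‖1 - hdot ζ η‖ ^ (-(2 * α))

/-- The quadratic form `∬ conj (f ζ) * k ζ η * f η dζ dη` with kernel `k`. -/
def quadForm {n : ℕ} (k : CSphere n → CSphere n → ℂ) (f : CSphere n → ℂ) : ℂ :=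
  ∫ p : CSphere n × CSphere n, star (f p.1) * k p.1 p.2 * f p.2
    ∂((sphereMeasure n).prod (sphereMeasure n))

/-- The double integral defining `quadForm k f` converges absolutely. -/
def QuadFormConverges {n : ℕ} (k : CSphere n → CSphere n → ℂ) (f : CSphere n → ℂ) : Prop :=
  Integrable (fun p : CSphere n × CSphere n => star (f p.1) * k p.1 p.2 * f p.2)
    ((sphereMeasure n).prod (sphereMeasure n))

end

/-! Write w = ζ · η̄. Both kernels are invariant under the unitary group, so each acts as a scalar
on the spherical harmonics of bidegree (p, q), and the inequality is a comparison of eigenvalues.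
The ratio of the eigenvalue for A to the eigenvalue for B is 2 - (n+1-2α) (s_p / (q+n+1-α) + s_q /
(p+n+1-α)), where s_0 = 1 and s_p = (α-1)/(p+α-1) for p ≥ 1. Since s_p ≤ 1 and n+1-2α > 0, this is
smallest at (0, 0) and only there, with value 2α/(n+1-α) (`eigenRatio_zero`, `lt_eigenRatio`).

The decomposition of L² is never constructed. The kernel |1-w|^(-2α) = (1-w)^(-α) (1-w̄)^(-α) is a
double power series in w and w̄ with positive coefficients. Each w^p w̄^q is a positive combination
of zonal harmonic kernels of bidegrees (p-k, q-k) (`pow_mul_star_pow_eq_sum`); this is algebra with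
the Fischer product, for which multiplication by |z|² is adjoint to the complex Laplacian. The zonal
kernels are positive semidefinite, so they assign energies E(p, q) ≥ 0 to f
(`quadForm_harmonicKernel`). Summation along diagonals gives B = ∑ S(p, q) E(p, q) with S a Gauss
series at 1. The factor w + w̄ shifts indices, and a contiguous relation (`hasSum_contiguous`)
yields the eigenvalue ratio without evaluating S (`energy_comparison`).

Only the absolute convergence of B is available for f, so the expansion is made for |1-rw| with r <
1; dominated convergence and the nonnegativity of all terms allow r → 1 (`hasSum_quadForm`).

Equality forces all energies off (0, 0) to vanish. Then f minus its mean is orthogonal to every w^p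
w̄^q, its Fourier transform is zero, and f is constant (`ae_const_of_harmonicEnergy_eq_zero`).
Conversely, constants have no other energy because harmonic polynomials of positive degree have mean
zero on the sphere (`harmonicEnergy_const`). -/

noncomputable section

open MvPolynomial

/-! ### The Fischer inner product. -/

section Fischer

variable {σ : Type*} [Fintype σ]

/-- The factorial of a multi-index. -/
def multiFactorial (s : σ →₀ ℕ) : ℕ := ∏ i, (s i).factorial

lemma multiFactorial_single_add (s : σ →₀ ℕ) (i : σ) :
    multiFactorial (Finsupp.single i 1 + s) = (s i + 1) * multiFactorial s := by
  classical
  unfold multiFactorial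
  rw [← Finset.mul_prod_erase _ _ (Finset.mem_univ i),
    ← Finset.mul_prod_erase (a := i) (f := fun j => (s j).factorial) _ (Finset.mem_univ i),
    ← mul_assoc]
  congr 1
  · simp [add_comm 1, Nat.factorial_succ]
  · refine Finset.prod_congr rfl fun j hj => ?_
    rw [Finsupp.add_apply, Finsupp.single_eq_of_ne (Finset.ne_of_mem_erase hj), zero_add]

/-- The Fischer (Bombieri) inner product on polynomials, antilinear in the first variable. -/
def fischer (p q : MvPolynomial σ ℂ) : ℂ :=
  ∑ s ∈ p.support, (multiFactorial s : ℂ) * (star (coeff s p) * coeff s q)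

lemma fischer_eq_sum {p : MvPolynomial σ ℂ} {T : Finset (σ →₀ ℕ)} (h : p.support ⊆ T)
    (q : MvPolynomial σ ℂ) :
    fischer p q = ∑ s ∈ T, (multiFactorial s : ℂ) * (star (coeff s p) * coeff s q) := by
  refine Finset.sum_subset h fun s _ hs => ?_
  simp [notMem_support_iff.1 hs]

lemma star_fischer (p q : MvPolynomial σ ℂ) : star (fischer p q) = fischer q p := by
  classical
  rw [fischer_eq_sum Finset.subset_union_left q (T := p.support ∪ q.support),
    fischer_eq_sum Finset.subset_union_right p (T := p.support ∪ q.support), star_sum]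
  refine Finset.sum_congr rfl fun s _ => ?_
  simp [mul_comm]

lemma fischer_add_right (p q r : MvPolynomial σ ℂ) :
    fischer p (q + r) = fischer p q + fischer p r := by
  simp [fischer, mul_add, Finset.sum_add_distrib]

lemma fischer_smul_right (p q : MvPolynomial σ ℂ) (c : ℂ) :
    fischer p (c • q) = c * fischer p q := by
  simp only [fischer, coeff_smul, smul_eq_mul, Finset.mul_sum]
  exact Finset.sum_congr rfl fun s _ => by ring

/-- The Fischer product as a linear map in the second variable. -/
def fischerLin (p : MvPolynomial σ ℂ) : MvPolynomial σ ℂ →ₗ[ℂ] ℂ where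
  toFun := fischer p
  map_add' := fischer_add_right p
  map_smul' c q := fischer_smul_right p q c

lemma fischer_sum_right {κ : Type*} (p : MvPolynomial σ ℂ) (T : Finset κ)
    (q : κ → MvPolynomial σ ℂ) : fischer p (∑ i ∈ T, q i) = ∑ i ∈ T, fischer p (q i) :=
  map_sum (fischerLin p) q T

lemma fischer_sum_left {κ : Type*} (T : Finset κ) (p : κ → MvPolynomial σ ℂ)
    (q : MvPolynomial σ ℂ) : fischer (∑ i ∈ T, p i) q = ∑ i ∈ T, fischer (p i) q := by
  rw [← star_fischer, fischer_sum_right, star_sum]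
  exact Finset.sum_congr rfl fun i _ => star_fischer _ _

lemma fischer_smul_left (p q : MvPolynomial σ ℂ) (c : ℂ) :
    fischer (c • p) q = star c * fischer p q := by
  rw [← star_fischer, fischer_smul_right, star_mul', star_fischer]

/-- The factorial weight is what makes this hold: raising the exponent of `X i` by one multiplies s!
by s i + 1, the factor that differentiation produces. -/
lemma fischer_X_mul (i : σ) (p q : MvPolynomial σ ℂ) :
    fischer (X i * p) q = fischer p (pderiv i q) := by
  rw [fischer, support_X_mul, Finset.sum_map, fischer]
  refine Finset.sum_congr rfl fun s _ => ?_
  rw [addLeftEmbedding_apply, coeff_X_mul, coeff_pderiv, multiFactorial_single_add, add_comm s]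
  push_cast
  ring

end Fischer

/-! ### Bihomogeneous polynomials, |z|² and the complex Laplacian. -/

section BiPoly

variable {ι : Type*}

/-- `P` is homogeneous of degree `p` in the first and `q` in the second group of variables. -/
def IsBihomogeneous (P : MvPolynomial (ι ⊕ ι) ℂ) (p q : ℕ) : Prop :=
  IsWeightedHomogeneous (Sum.elim (fun _ => 1) (fun _ => 0)) P p ∧
    IsWeightedHomogeneous (Sum.elim (fun _ => 0) (fun _ => 1)) P q

namespace IsBihomogeneous

variable {P R : MvPolynomial (ι ⊕ ι) ℂ} {p q p' q' : ℕ}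

lemma mul (hP : IsBihomogeneous P p q) (hR : IsBihomogeneous R p' q') :
    IsBihomogeneous (P * R) (p + p') (q + q') :=
  ⟨hP.1.mul hR.1, hP.2.mul hR.2⟩

lemma pow (hP : IsBihomogeneous P p q) (k : ℕ) : IsBihomogeneous (P ^ k) (k * p) (k * q) :=
  ⟨by simpa using hP.1.pow k, by simpa using hP.2.pow k⟩

lemma smul (hP : IsBihomogeneous P p q) (c : ℂ) : IsBihomogeneous (c • P) p q :=
  ⟨(weightedHomogeneousSubmodule ℂ _ p).smul_mem c hP.1,
    (weightedHomogeneousSubmodule ℂ _ q).smul_mem c hP.2⟩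

lemma sum {κ : Type*} {T : Finset κ} {P : κ → MvPolynomial (ι ⊕ ι) ℂ}
    (h : ∀ i ∈ T, IsBihomogeneous (P i) p q) : IsBihomogeneous (∑ i ∈ T, P i) p q :=
  ⟨(weightedHomogeneousSubmodule ℂ _ p).sum_mem fun i hi => (h i hi).1,
    (weightedHomogeneousSubmodule ℂ _ q).sum_mem fun i hi => (h i hi).2⟩

lemma X_inl (i : ι) : IsBihomogeneous (X (Sum.inl i)) 1 0 :=
  ⟨isWeightedHomogeneous_X _ _ _, isWeightedHomogeneous_X _ _ _⟩

lemma X_inr (i : ι) : IsBihomogeneous (X (Sum.inr i)) 0 1 :=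
  ⟨isWeightedHomogeneous_X _ _ _, isWeightedHomogeneous_X _ _ _⟩

lemma pderiv_inl (hP : IsBihomogeneous P (p + 1) q) (i : ι) :
    IsBihomogeneous (pderiv (Sum.inl i) P) p q :=
  ⟨hP.1.pderiv rfl, hP.2.pderiv rfl⟩

lemma pderiv_inr (hP : IsBihomogeneous P p (q + 1)) (i : ι) :
    IsBihomogeneous (pderiv (Sum.inr i) P) p q :=
  ⟨hP.1.pderiv rfl, hP.2.pderiv rfl⟩

end IsBihomogeneous

variable [Fintype ι]

/-- The quadratic polynomial `∑ i, x i * y i`, standing for `|z|²`. -/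
def normPoly : MvPolynomial (ι ⊕ ι) ℂ := ∑ i : ι, X (Sum.inl i) * X (Sum.inr i)

/-- Multiplication by `|z|²`. -/
def normMul : MvPolynomial (ι ⊕ ι) ℂ →ₗ[ℂ] MvPolynomial (ι ⊕ ι) ℂ :=
  LinearMap.mulLeft ℂ normPoly

/-- The complex Laplacian `∑ i, ∂_{x i} ∂_{y i}`. -/
def complexLaplacian : MvPolynomial (ι ⊕ ι) ℂ →ₗ[ℂ] MvPolynomial (ι ⊕ ι) ℂ :=
  ∑ i : ι, (pderiv (Sum.inl i)).toLinearMap ∘ₗ (pderiv (Sum.inr i)).toLinearMap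

lemma complexLaplacian_apply (P : MvPolynomial (ι ⊕ ι) ℂ) :
    complexLaplacian P = ∑ i : ι, pderiv (Sum.inl i) (pderiv (Sum.inr i) P) := by
  simp [complexLaplacian]

lemma normMul_apply (P : MvPolynomial (ι ⊕ ι) ℂ) : normMul P = normPoly * P := rfl

lemma fischer_normMul_left (P R : MvPolynomial (ι ⊕ ι) ℂ) :
    fischer (normMul P) R = fischer P (complexLaplacian R) := by
  rw [normMul_apply, complexLaplacian_apply, normPoly, Finset.sum_mul, fischer_sum_left,
    fischer_sum_right]
  refine Finset.sum_congr rfl fun i _ => ?_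
  rw [mul_comm (X (Sum.inl i)), mul_assoc, fischer_X_mul, fischer_X_mul]

lemma fischer_normMul_right (P R : MvPolynomial (ι ⊕ ι) ℂ) :
    fischer P (normMul R) = fischer (complexLaplacian P) R := by
  rw [← star_fischer, fischer_normMul_left, star_fischer]

namespace IsBihomogeneous

variable {P R : MvPolynomial (ι ⊕ ι) ℂ} {p q : ℕ}

lemma normPoly : IsBihomogeneous (normPoly : MvPolynomial (ι ⊕ ι) ℂ) 1 1 :=
  sum fun i _ => (X_inl i).mul (X_inr i)

lemma normMul (hP : IsBihomogeneous P p q) : IsBihomogeneous (normMul P) (p + 1) (q + 1) := by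
  rw [normMul_apply, add_comm p, add_comm q]
  exact normPoly.mul hP

lemma sum_X_mul_pderiv_inl (hP : IsBihomogeneous P p q) :
    ∑ i, X (Sum.inl i) * pderiv (Sum.inl i) P = (p : ℂ) • P := by
  have := hP.1.sum_weight_X_mul_pderiv
  simpa [Nat.cast_smul_eq_nsmul] using this

lemma sum_X_mul_pderiv_inr (hP : IsBihomogeneous P p q) :
    ∑ i, X (Sum.inr i) * pderiv (Sum.inr i) P = (q : ℂ) • P := by
  have := hP.2.sum_weight_X_mul_pderiv
  simpa [Nat.cast_smul_eq_nsmul] using this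

/-- An sl₂-type commutation relation. In the Leibniz rule the two cross terms are Euler operators,
contributing p and q, and the Laplacian of |z|² contributes the dimension. -/
lemma complexLaplacian_normMul (hP : IsBihomogeneous P p q) :
    complexLaplacian (_root_.normMul P) =
      _root_.normMul (complexLaplacian P) + ((Fintype.card ι + p + q : ℕ) : ℂ) • P := by
  classical
  have hr (i : ι) : pderiv (Sum.inr i) (_root_.normPoly : MvPolynomial (ι ⊕ ι) ℂ) =
      X (Sum.inl i) := by
    simp [_root_.normPoly, pderiv_X, Pi.single_apply]
  have hl (i : ι) : pderiv (Sum.inl i) (_root_.normPoly : MvPolynomial (ι ⊕ ι) ℂ) =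
      X (Sum.inr i) := by
    simp [_root_.normPoly, pderiv_X, Pi.single_apply]
  have h1 := hP.sum_X_mul_pderiv_inl
  have h2 := hP.sum_X_mul_pderiv_inr
  simp only [complexLaplacian_apply, normMul_apply, Derivation.leibniz, map_add, hr, hl,
    smul_eq_mul, pderiv_X_self, Finset.sum_add_distrib, ← Finset.mul_sum]
  have h3 : ((Fintype.card ι + p + q : ℕ) : ℂ) • P =
      ∑ i : ι, P + (p : ℂ) • P + (q : ℂ) • P := by
    simp [add_smul, Nat.cast_smul_eq_nsmul]
  rw [h3, ← h1, ← h2]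
  have h4 : ∑ i : ι, pderiv (Sum.inr i) P * X (Sum.inr i) =
      ∑ i : ι, X (Sum.inr i) * pderiv (Sum.inr i) P :=
    Finset.sum_congr rfl fun i _ => mul_comm _ _
  have h5 : ∑ i : ι, P = P * ∑ i : ι, 1 := by simp [mul_comm]
  rw [h4, h5]
  ring

end IsBihomogeneous

end BiPoly

end

noncomputable section

open MvPolynomial

/-! ### Primitive decomposition for an abstract raising and lowering pair. -/

section PrimitiveParts

/-- The coefficient of `E ^ k (h (p - k) (q - k))` in `m p q`. -/
def primCoeff (n p q k : ℕ) : ℂ :=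
  (p.factorial * q.factorial * (p + q - 2 * k + n).factorial : ℕ) /
    ((p - k).factorial * (q - k).factorial * k.factorial * (p + q - k + n).factorial : ℕ)

lemma primCoeff_zero (n p q : ℕ) : primCoeff n p q 0 = 1 := by
  rw [primCoeff, div_eq_one_iff_eq]
  · simp
  · exact_mod_cast by positivity

/-- This recursion determines the coefficients: it is the condition that lowering the decomposition
of m (p+1) (q+1) gives (p+1)(q+1) times that of m p q, term by term. -/
lemma primCoeff_succ (n p q k : ℕ) (hp : k ≤ p) (hq : k ≤ q) :
    primCoeff n (p + 1) (q + 1) (k + 1) * ((k + 1) * (p + q + 1 - k + n) : ℕ) =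
      (p + 1) * (q + 1) * primCoeff n p q k := by
  obtain ⟨p, rfl⟩ := Nat.exists_eq_add_of_le hp
  obtain ⟨q, rfl⟩ := Nat.exists_eq_add_of_le hq
  unfold primCoeff
  rw [show k + p + 1 - (k + 1) = p by omega, show k + q + 1 - (k + 1) = q by omega,
    show k + p + 1 + (k + q + 1) - 2 * (k + 1) + n = p + q + n by omega,
    show k + p + 1 + (k + q + 1) - (k + 1) + n = (k + p + q + n) + 1 by omega,
    show k + p + (k + q) + 1 - k + n = k + p + q + n + 1 by omega,
    show k + p + (k + q) - 2 * k + n = p + q + n by omega,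
    show k + p + (k + q) - k + n = k + p + q + n by omega,
    show k + p - k = p by omega, show k + q - k = q by omega]
  have h1 := Nat.factorial_ne_zero p
  have h2 := Nat.factorial_ne_zero q
  have h3 := Nat.factorial_ne_zero k
  have h4 := Nat.factorial_ne_zero (k + p + q + n)
  simp only [Nat.factorial_succ]
  push_cast
  have h5 : ((k : ℂ) + 1) ≠ 0 := by exact_mod_cast Nat.succ_ne_zero k
  have h6 : ((k : ℂ) + p + q + n + 1) ≠ 0 := by exact_mod_cast Nat.succ_ne_zero (k + p + q + n)
  field_simp

variable {V : Type*} [AddCommGroup V] [Module ℂ V]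

/-- The primitive parts `h p q` of a family `m p q`, characterised by
`m p q = ∑ k ≤ min p q, primCoeff n p q k • E ^ k (h (p - k) (q - k))`. -/
def primPart (n : ℕ) (E : Module.End ℂ V) (m : ℕ → ℕ → V) (p q : ℕ) : V :=
  m p q - ∑ k : Fin (min p q), primCoeff n p q (k + 1) •
    (E ^ (k + 1 : ℕ)) (primPart n E m (p - (k + 1)) (q - (k + 1)))
termination_by q
decreasing_by omega

lemma primPart_eq (n : ℕ) (E : Module.End ℂ V) (m : ℕ → ℕ → V) (p q : ℕ) :
    primPart n E m p q = m p q - ∑ k ∈ Finset.range (min p q), primCoeff n p q (k + 1) •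
      (E ^ (k + 1)) (primPart n E m (p - (k + 1)) (q - (k + 1))) := by
  rw [primPart, Finset.sum_range]

lemma sum_primPart (n : ℕ) (E : Module.End ℂ V) (m : ℕ → ℕ → V) (p q : ℕ) :
    m p q = ∑ k ∈ Finset.range (min p q + 1), primCoeff n p q k •
      (E ^ k) (primPart n E m (p - k) (q - k)) := by
  rw [Finset.sum_range_succ', primPart_eq n E m (p - 0)]
  simp [primCoeff_zero]

/-- Closure properties of the family pass to its primitive parts. -/
lemma primPart_induction (n : ℕ) (E : Module.End ℂ V) (m : ℕ → ℕ → V)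
    (W : ℕ → ℕ → Submodule ℂ V) (hm : ∀ p q, m p q ∈ W p q)
    (hE : ∀ p q, ∀ v ∈ W p q, E v ∈ W (p + 1) (q + 1)) (p q : ℕ) :
    primPart n E m p q ∈ W p q := by
  have hEk (k : ℕ) : ∀ p q, ∀ v ∈ W p q, (E ^ k) v ∈ W (p + k) (q + k) := by
    induction k with
    | zero => intro p q v hv; simpa
    | succ k ih =>
      intro p q v hv
      rw [pow_succ', Module.End.mul_apply]
      exact hE _ _ _ (ih p q v hv)
  induction q using Nat.strong_induction_on generalizing p with
  | _ q ih =>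
    rw [primPart_eq]
    refine (W p q).sub_mem (hm p q) ((W p q).sum_mem fun k hk => (W p q).smul_mem _ ?_)
    rw [Finset.mem_range] at hk
    have := hEk (k + 1) _ _ _ (ih (q - (k + 1)) (by omega) (p - (k + 1)))
    rwa [Nat.sub_add_cancel (by omega), Nat.sub_add_cancel (by omega)] at this

variable {n : ℕ} {D E : Module.End ℂ V} {W : ℕ → ℕ → Submodule ℂ V}

/-- Commuting D past k + 1 copies of E adds up n+1+p+q+2j over j ≤ k, which is (k+1)(n+1+p+q+k).
Membership is carried through the induction because the commutator depends on the bidegree. -/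
lemma lower_pow_of_primitive (hE : ∀ p q, ∀ v ∈ W p q, E v ∈ W (p + 1) (q + 1))
    (hDE : ∀ p q, ∀ v ∈ W p q, D (E v) = E (D v) + ((n + 1 + p + q : ℕ) : ℂ) • v)
    {p q : ℕ} {v : V} (hv : v ∈ W p q) (hD : D v = 0) (k : ℕ) :
    (E ^ k) v ∈ W (p + k) (q + k) ∧
    D ((E ^ (k + 1)) v) = (((k + 1) * (n + 1 + p + q + k) : ℕ) : ℂ) • (E ^ k) v := by
  induction k with
  | zero => simp [hDE p q v hv, hv, hD]
  | succ k ih =>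
    have hmem : (E ^ (k + 1)) v ∈ W (p + (k + 1)) (q + (k + 1)) := by
      rw [pow_succ', Module.End.mul_apply]
      exact hE _ _ _ ih.1
    refine ⟨hmem, ?_⟩
    rw [pow_succ', Module.End.mul_apply, hDE _ _ _ hmem, ih.2, map_smul, ← Module.End.mul_apply,
      ← pow_succ', ← add_smul]
    congr 1
    push_cast
    ring

/-- The primitive parts are annihilated by the lowering operator. -/
lemma lower_primPart {m : ℕ → ℕ → V} (hm : ∀ p q, m p q ∈ W p q)
    (hE : ∀ p q, ∀ v ∈ W p q, E v ∈ W (p + 1) (q + 1))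
    (hDE : ∀ p q, ∀ v ∈ W p q, D (E v) = E (D v) + ((n + 1 + p + q : ℕ) : ℂ) • v)
    (hD0 : ∀ p q, min p q = 0 → D (m p q) = 0)
    (hD : ∀ p q, D (m (p + 1) (q + 1)) = (((p + 1) * (q + 1) : ℂ)) • m p q) (p q : ℕ) :
    D (primPart n E m p q) = 0 := by
  induction q using Nat.strong_induction_on generalizing p with
  | _ q ih =>
    rcases Nat.eq_zero_or_pos (min p q) with h0 | hpos
    · rw [primPart_eq, h0]
      simpa using hD0 p q h0
    obtain ⟨p, rfl⟩ : ∃ p', p = p' + 1 := ⟨p - 1, by omega⟩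
    obtain ⟨q, rfl⟩ : ∃ q', q = q' + 1 := ⟨q - 1, by omega⟩
    -- Both sides become sums over E ^ k of the same primitive parts, with m p q expanded by its own
    -- decomposition; the induction hypothesis lets D lower each power of E.
    rw [primPart_eq, map_sub, hD, sum_primPart n E m p q, map_sum, Finset.smul_sum,
      show min (p + 1) (q + 1) = min p q + 1 by omega, sub_eq_zero]
    refine Finset.sum_congr rfl fun k hk => ?_
    rw [Finset.mem_range] at hk
    have hmem := primPart_induction n E m W hm hE (p - k) (q - k)
    have hprim := ih (q - k) (by omega) (p - k)
    rw [Nat.add_sub_add_right, Nat.add_sub_add_right, map_smul,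
      (lower_pow_of_primitive hE hDE hmem hprim k).2, smul_smul, smul_smul]
    congr 1
    rw [← primCoeff_succ n p q k (by omega) (by omega)]
    congr 3
    omega

end PrimitiveParts

end

noncomputable section

open MvPolynomial

/-! ### Zonal polynomials, their harmonic parts and the zonal kernels. -/

section Zonal

variable {ι : Type*}

lemma IsBihomogeneous.isHomogeneous [Fintype ι] {P : MvPolynomial (ι ⊕ ι) ℂ} {p q : ℕ}
    (hP : IsBihomogeneous P p q) : P.IsHomogeneous (p + q) := by
  intro s hs
  have h1 := hP.1 hs
  have h2 := hP.2 hs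
  rw [Finsupp.weight_apply, Finsupp.sum_fintype _ _ (by simp)] at *
  rw [← h1, ← h2]
  simp

variable [Fintype ι]

/-- The linear form `∑ i, u i * x i`. -/
def linX (u : ι → ℂ) : MvPolynomial (ι ⊕ ι) ℂ := ∑ i, u i • X (Sum.inl i)

/-- The linear form `∑ i, u i * y i`. -/
def linY (u : ι → ℂ) : MvPolynomial (ι ⊕ ι) ℂ := ∑ i, u i • X (Sum.inr i)

/-- The polynomial standing for `z ↦ (z · v̄) ^ p * (z̄ · v) ^ q`. -/
def zonal (v : ι → ℂ) (p q : ℕ) : MvPolynomial (ι ⊕ ι) ℂ := linX (star v) ^ p * linY v ^ q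

lemma isBihomogeneous_zonal (v : ι → ℂ) (p q : ℕ) : IsBihomogeneous (zonal v p q) p q := by
  have hX : IsBihomogeneous (linX (star v)) 1 0 :=
    IsBihomogeneous.sum fun i _ => (IsBihomogeneous.X_inl i).smul _
  have hY : IsBihomogeneous (linY v) 0 1 :=
    IsBihomogeneous.sum fun i _ => (IsBihomogeneous.X_inr i).smul _
  simpa [zonal] using (hX.pow p).mul (hY.pow q)

lemma pderiv_inl_linX (u : ι → ℂ) (i : ι) : pderiv (Sum.inl i) (linX u) = C (u i) := by
  classical
  simp [linX, pderiv_X, Pi.single_apply, smul_eq_C_mul]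

lemma pderiv_inr_linX (u : ι → ℂ) (i : ι) : pderiv (Sum.inr i) (linX u) = 0 := by
  classical
  simp [linX, pderiv_X]

lemma pderiv_inr_linY (u : ι → ℂ) (i : ι) : pderiv (Sum.inr i) (linY u) = C (u i) := by
  classical
  simp [linY, pderiv_X, Pi.single_apply, smul_eq_C_mul]

lemma pderiv_inl_linY (u : ι → ℂ) (i : ι) : pderiv (Sum.inl i) (linY u) = 0 := by
  classical
  simp [linY, pderiv_X]

lemma complexLaplacian_zonal_succ {v : ι → ℂ} (hv : ∑ i, v i * star (v i) = 1) (p q : ℕ) :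
    complexLaplacian (zonal v (p + 1) (q + 1)) =
      (((p + 1) * (q + 1) : ℂ)) • zonal v p q := by
  have key (i : ι) : pderiv (Sum.inl i) (pderiv (Sum.inr i) (zonal v (p + 1) (q + 1))) =
      (v i * star (v i)) • (((p + 1) * (q + 1) : ℂ)) • zonal v p q := by
    simp only [zonal, Derivation.leibniz, Derivation.leibniz_pow, pderiv_inr_linX,
      pderiv_inr_linY, pderiv_inl_linX, pderiv_inl_linY, map_add, smul_eq_mul, mul_zero, smul_zero,
      add_zero, zero_add, nsmul_eq_mul, Nat.add_sub_cancel, smul_eq_C_mul, C_mul,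
      pderiv_C, Derivation.map_natCast, Pi.star_apply, C_1, map_natCast]
    push_cast
    ring
  rw [complexLaplacian_apply, Finset.sum_congr rfl fun i _ => key i, ← Finset.sum_smul, hv,
    one_smul]

lemma complexLaplacian_zonal_of_min (v : ι → ℂ) (p q : ℕ) (h : min p q = 0) :
    complexLaplacian (zonal v p q) = 0 := by
  rw [complexLaplacian_apply]
  refine Finset.sum_eq_zero fun i _ => ?_
  rcases (by omega : p = 0 ∨ q = 0) with rfl | rfl
  · simp [zonal, Derivation.leibniz_pow, pderiv_inr_linY, pderiv_inl_linY]
  · simp [zonal, Derivation.leibniz_pow, pderiv_inr_linX]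

lemma fischer_linX_mul (u : ι → ℂ) (P R : MvPolynomial (ι ⊕ ι) ℂ) :
    fischer (linX u * P) R = fischer P (∑ i, star (u i) • pderiv (Sum.inl i) R) := by
  simp only [linX, Finset.sum_mul, fischer_sum_left, fischer_sum_right, smul_mul_assoc,
    fischer_smul_left, fischer_smul_right, fischer_X_mul]

lemma fischer_linY_mul (u : ι → ℂ) (P R : MvPolynomial (ι ⊕ ι) ℂ) :
    fischer (linY u * P) R = fischer P (∑ i, star (u i) • pderiv (Sum.inr i) R) := by
  simp only [linY, Finset.sum_mul, fischer_sum_left, fischer_sum_right, smul_mul_assoc,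
    fischer_smul_left, fischer_smul_right, fischer_X_mul]

/-- Evaluation at `x = v`, `y = v̄`. -/
def evalStar (v : ι → ℂ) : MvPolynomial (ι ⊕ ι) ℂ →+* ℂ := eval (Sum.elim v (star v))

/-- The zonal polynomials reproduce point values for the Fischer inner product. -/
lemma fischer_zonal (v : ι → ℂ) {p q : ℕ} {P : MvPolynomial (ι ⊕ ι) ℂ}
    (hP : IsBihomogeneous P p q) :
    fischer (zonal v p q) P = p.factorial * q.factorial * evalStar v P := by
  -- Each linear factor crosses the product as the derivative in direction v, or v̄ for the second
  -- group, and Euler's identity evaluates that derivative at v.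
  induction p generalizing P with
  | succ p ih =>
    have h1 : zonal v (p + 1) q = linX (star v) * zonal v p q := by simp only [zonal]; ring
    have h2 : evalStar v (∑ i, star (star v i) • pderiv (Sum.inl i) P) =
        (p + 1) * evalStar v P := by
      have := congrArg (evalStar v) hP.sum_X_mul_pderiv_inl
      simpa [evalStar, smul_eval] using this
    rw [h1, fischer_linX_mul, ih (IsBihomogeneous.sum fun i _ => (hP.pderiv_inl i).smul _), h2]
    push_cast [Nat.factorial_succ]
    ring
  | zero =>
    induction q generalizing P with
    | succ q ih =>
      have h1 : zonal v 0 (q + 1) = linY v * zonal v 0 q := by simp only [zonal]; ring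
      have h2 : evalStar v (∑ i, star (v i) • pderiv (Sum.inr i) P) =
          (q + 1) * evalStar v P := by
        have := congrArg (evalStar v) hP.sum_X_mul_pderiv_inr
        simpa [evalStar, smul_eval] using this
      rw [h1, fischer_linY_mul, ih (IsBihomogeneous.sum fun i _ => (hP.pderiv_inr i).smul _), h2]
      push_cast [Nat.factorial_succ]
      ring
    | zero =>
      have h0 := hP.isHomogeneous
      rw [add_zero, ← totalDegree_zero_iff_isHomogeneous, totalDegree_eq_zero_iff_eq_C] at h0
      rw [h0]
      simp [zonal, fischer, evalStar, support_one, multiFactorial]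

lemma evalStar_zonal (u v : ι → ℂ) (p q : ℕ) :
    evalStar u (zonal v p q) = (∑ i, u i * star (v i)) ^ p * star (∑ i, u i * star (v i)) ^ q := by
  simp [evalStar, zonal, linX, linY, smul_eval, mul_comm]

variable {n : ℕ} {u v : ι → ℂ}

/-- The harmonic part of the zonal polynomial. -/
def harmonicZonal (n : ℕ) (v : ι → ℂ) (p q : ℕ) : MvPolynomial (ι ⊕ ι) ℂ :=
  primPart n normMul (zonal v) p q

lemma zonal_eq_sum (n : ℕ) (v : ι → ℂ) (p q : ℕ) :
    zonal v p q = ∑ k ∈ Finset.range (min p q + 1), primCoeff n p q k •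
      (normMul ^ k) (harmonicZonal n v (p - k) (q - k)) :=
  sum_primPart n normMul (zonal v) p q

/-- The space of bihomogeneous polynomials. -/
def bihomogeneousSubmodule (ι : Type*) (p q : ℕ) : Submodule ℂ (MvPolynomial (ι ⊕ ι) ℂ) :=
  weightedHomogeneousSubmodule ℂ (Sum.elim (fun _ => 1) (fun _ => 0)) p ⊓
    weightedHomogeneousSubmodule ℂ (Sum.elim (fun _ => 0) (fun _ => 1)) q

lemma isBihomogeneous_harmonicZonal (n : ℕ) (v : ι → ℂ) (p q : ℕ) :
    IsBihomogeneous (harmonicZonal n v p q) p q :=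
  primPart_induction n normMul (zonal v) (bihomogeneousSubmodule ι)
    (isBihomogeneous_zonal v) (fun _ _ _ hv => IsBihomogeneous.normMul hv) p q

lemma complexLaplacian_harmonicZonal (hn : Fintype.card ι = n + 1)
    (hv : ∑ i, v i * star (v i) = 1) (p q : ℕ) :
    complexLaplacian (harmonicZonal n v p q) = 0 :=
  lower_primPart (W := bihomogeneousSubmodule ι) (isBihomogeneous_zonal v)
    (fun _ _ _ hv => IsBihomogeneous.normMul hv)
    (fun _ _ _ hv => hn ▸ IsBihomogeneous.complexLaplacian_normMul hv)
    (complexLaplacian_zonal_of_min v) (complexLaplacian_zonal_succ hv) p q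

lemma fischer_normMul_pow_right (k : ℕ) (P R : MvPolynomial (ι ⊕ ι) ℂ) :
    fischer P ((normMul ^ k) R) = fischer ((complexLaplacian ^ k) P) R := by
  induction k generalizing P with
  | zero => simp
  | succ k ih =>
    rw [pow_succ', Module.End.mul_apply, fischer_normMul_right, ih, pow_succ, Module.End.mul_apply]

lemma complexLaplacian_pow_zonal (hv : ∑ i, v i * star (v i) = 1) (p q k : ℕ) :
    (complexLaplacian ^ k) (zonal v (p + k) (q + k)) =
      (((p + k).factorial * (q + k).factorial : ℂ) / (p.factorial * q.factorial)) •
        zonal v p q := by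
  have hp : (p.factorial : ℂ) ≠ 0 := by exact_mod_cast p.factorial_ne_zero
  have hq : (q.factorial : ℂ) ≠ 0 := by exact_mod_cast q.factorial_ne_zero
  induction k with
  | zero => simp [div_self (mul_ne_zero hp hq)]
  | succ k ih =>
    rw [pow_succ, Module.End.mul_apply, ← add_assoc, ← add_assoc, complexLaplacian_zonal_succ hv,
      map_smul, ih, smul_smul]
    congr 1
    simp only [Nat.factorial_succ]
    push_cast
    ring

/-- The difference of the two left arguments is divisible by |z|², and powers of |z|² pass to the
other side as Laplacians, which kill the harmonic part at v. -/
lemma fischer_zonal_harmonicZonal (hn : Fintype.card ι = n + 1)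
    (hv : ∑ i, v i * star (v i) = 1) (p q : ℕ) :
    fischer (zonal u p q) (harmonicZonal n v p q) =
      fischer (harmonicZonal n u p q) (harmonicZonal n v p q) := by
  rw [zonal_eq_sum n u, fischer_sum_left, Finset.sum_range_succ', Finset.sum_eq_zero]
  · simp [primCoeff_zero]
  · intro k _
    rw [fischer_smul_left, ← star_fischer, fischer_normMul_pow_right, pow_succ,
      Module.End.mul_apply, complexLaplacian_harmonicZonal hn hv]
    simp [fischer]

/-- The zonal harmonic kernel of bidegree `(p, q)`. -/
def harmonicKernel (n : ℕ) (p q : ℕ) (u v : ι → ℂ) : ℂ :=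
  (p + q + n).factorial / ((p.factorial * q.factorial) ^ 2 : ℕ) *
    fischer (harmonicZonal n u p q) (harmonicZonal n v p q)

/-- The Fischer form of the kernel displays its positivity; this form shows that it is a harmonic
polynomial in u, which is needed to integrate it over the sphere. -/
lemma harmonicKernel_eq_eval (hn : Fintype.card ι = n + 1)
    (hv : ∑ i, v i * star (v i) = 1) (p q : ℕ) :
    harmonicKernel n p q u v =
      (p + q + n).factorial / (p.factorial * q.factorial) * evalStar u (harmonicZonal n v p q) := by
  have hp : (p.factorial : ℂ) ≠ 0 := by exact_mod_cast p.factorial_ne_zero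
  have hq : (q.factorial : ℂ) ≠ 0 := by exact_mod_cast q.factorial_ne_zero
  rw [harmonicKernel, ← fischer_zonal_harmonicZonal hn hv,
    fischer_zonal u (isBihomogeneous_harmonicZonal n v p q)]
  push_cast
  field_simp

/-- Expansion of `w ^ p * w̄ ^ q`, `w = u · v̄`, into zonal harmonic kernels. -/
lemma pow_mul_star_pow_eq_sum (hn : Fintype.card ι = n + 1)
    (hu : ∑ i, u i * star (u i) = 1) (hv : ∑ i, v i * star (v i) = 1) (p q : ℕ) :
    (∑ i, u i * star (v i)) ^ p * star (∑ i, u i * star (v i)) ^ q =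
      ∑ k ∈ Finset.range (min p q + 1),
        (p.factorial * q.factorial / (k.factorial * (p + q - k + n).factorial) : ℂ) *
          harmonicKernel n (p - k) (q - k) u v := by
  have hp : (p.factorial : ℂ) ≠ 0 := by exact_mod_cast p.factorial_ne_zero
  have hq : (q.factorial : ℂ) ≠ 0 := by exact_mod_cast q.factorial_ne_zero
  -- The product of the zonal polynomials at u and v is computed twice: by the reproducing property,
  -- and by decomposing the one at v and moving the powers of |z|² onto the one at u as Laplacians.
  have h1 := fischer_zonal u (isBihomogeneous_zonal v p q)
  rw [evalStar_zonal] at h1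
  have h2 : fischer (zonal u p q) (zonal v p q) = ∑ k ∈ Finset.range (min p q + 1),
      p.factorial * q.factorial *
      ((p.factorial * q.factorial / (k.factorial * (p + q - k + n).factorial) : ℂ) *
          harmonicKernel n (p - k) (q - k) u v) := by
    rw [zonal_eq_sum n v, fischer_sum_right]
    refine Finset.sum_congr rfl fun k hk => ?_
    rw [Finset.mem_range] at hk
    obtain ⟨p, rfl⟩ := Nat.exists_eq_add_of_le' (show k ≤ p by omega)
    obtain ⟨q, rfl⟩ := Nat.exists_eq_add_of_le' (show k ≤ q by omega)
    rw [Nat.add_sub_cancel, Nat.add_sub_cancel, fischer_smul_right, fischer_normMul_pow_right,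
      complexLaplacian_pow_zonal hu, fischer_smul_left, fischer_zonal_harmonicZonal hn hv,
      harmonicKernel, primCoeff, Nat.add_sub_cancel, Nat.add_sub_cancel,
      show p + k + (q + k) - 2 * k + n = p + q + n by omega]
    have e1 := Nat.factorial_ne_zero p
    have e2 := Nat.factorial_ne_zero q
    have e3 := Nat.factorial_ne_zero k
    have e4 := Nat.factorial_ne_zero (p + k + (q + k) - k + n)
    simp only [star_div₀, star_mul', star_natCast]
    push_cast
    field_simp
  rw [← Finset.mul_sum] at h2
  exact mul_left_cancel₀ (mul_ne_zero hp hq) (h1.symm.trans h2)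

end Zonal

end

noncomputable section

open MvPolynomial

/-! ### Gaussian moments on the complex plane. -/

section GaussianMoments

/-- The moment `∫ z ^ a * z̄ ^ b * exp (-|z|²)` over the complex plane. -/
def gaussMoment (a b : ℕ) : ℂ := ∫ z : ℂ, z ^ a * star z ^ b * (Real.exp (-‖z‖ ^ 2) : ℂ)

/-- Rotation by the angle π / (a - b) preserves the measure and the weight but changes the sign of
the integrand. -/
lemma gaussMoment_of_ne {a b : ℕ} (h : a ≠ b) : gaussMoment a b = 0 := by
  have hab : ((a : ℂ) - b) ≠ 0 := sub_ne_zero.2 (by exact_mod_cast h)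
  set c : Circle := Circle.exp (Real.pi / ((a : ℝ) - b)) with hc
  have hc' : (c : ℂ) ^ a * star (c : ℂ) ^ b = -1 := by
    rw [hc, Circle.coe_exp, RCLike.star_def, ← Complex.exp_conj, ← Complex.exp_nat_mul,
      ← Complex.exp_nat_mul, ← Complex.exp_add, ← Complex.exp_pi_mul_I]
    congr 1
    simp only [map_mul, Complex.conj_ofReal, Complex.conj_I]
    push_cast
    field_simp
    ring
  have key : gaussMoment a b = -gaussMoment a b := by
    have hmp := (rotation c).measurePreserving
    have := hmp.integral_comp (rotation c).toHomeomorph.measurableEmbedding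
      (fun z : ℂ => z ^ a * star z ^ b * (Real.exp (-‖z‖ ^ 2) : ℂ))
    rw [← gaussMoment] at this
    refine this.symm.trans ?_
    rw [← neg_one_mul, ← hc', gaussMoment, ← integral_const_mul]
    congr 1
    ext z
    rw [rotation_apply, norm_mul, Circle.norm_coe, one_mul, star_mul', mul_pow, mul_pow]
    ring
  exact self_eq_neg.1 key

lemma gaussMoment_self (a : ℕ) : gaussMoment a a = Real.pi * a.factorial := by
  have h := Complex.integral_rpow_mul_exp_neg_rpow (p := 2) (q := 2 * a) (by norm_num)
    (by have : (0 : ℝ) ≤ a := a.cast_nonneg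
        linarith)
  have h2 : (2 * (a : ℝ) + 2) / 2 = a + 1 := by ring
  rw [h2, Real.Gamma_nat_eq_factorial] at h
  have : gaussMoment a a =
      ((∫ z : ℂ, ‖z‖ ^ (2 * a : ℝ) * Real.exp (-‖z‖ ^ (2 : ℝ)) : ℝ) : ℂ) := by
    rw [gaussMoment, ← integral_complex_ofReal]
    congr 1
    ext z
    rw [← mul_pow, RCLike.star_def, Complex.mul_conj, Complex.normSq_eq_norm_sq]
    rw [show (2 * a : ℝ) = ((2 * a : ℕ) : ℝ) by push_cast; ring, Real.rpow_natCast,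
      Real.rpow_two, pow_mul]
    push_cast
    rfl
  rw [this, h]
  push_cast
  field_simp

/-- Integration by parts in one variable. The truncated a - 1 is harmless at a = 0, where the factor
a vanishes. -/
lemma gaussMoment_succ_right (a b : ℕ) :
    gaussMoment a (b + 1) = a * gaussMoment (a - 1) b := by
  rcases a with _ | a
  · simp [gaussMoment_of_ne]
  by_cases h : a = b
  · subst h
    simp only [Nat.add_sub_cancel, gaussMoment_self, Nat.factorial_succ]
    push_cast
    ring
  · rw [gaussMoment_of_ne (by omega), Nat.add_sub_cancel, gaussMoment_of_ne h, mul_zero]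

lemma gaussMoment_succ_left (a b : ℕ) :
    gaussMoment (a + 1) b = b * gaussMoment a (b - 1) := by
  rcases b with _ | b
  · simp [gaussMoment_of_ne]
  by_cases h : a = b
  · subst h
    simp only [Nat.add_sub_cancel, gaussMoment_self, Nat.factorial_succ]
    push_cast
    ring
  · rw [gaussMoment_of_ne (by omega), Nat.add_sub_cancel, gaussMoment_of_ne h, mul_zero]

lemma integrable_gaussMoment (a b : ℕ) :
    Integrable fun z : ℂ => z ^ a * star z ^ b * (Real.exp (-‖z‖ ^ 2) : ℂ) := by
  have h := Complex.integral_rpow_mul_exp_neg_rpow (p := 2) (q := (a + b : ℕ)) (by norm_num)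
    (by have : (0 : ℝ) ≤ (a + b : ℕ) := Nat.cast_nonneg _
        linarith)
  have hint : Integrable fun z : ℂ =>
      ‖z‖ ^ ((a + b : ℕ) : ℝ) * Real.exp (-‖z‖ ^ (2 : ℝ)) := by
    -- The known value of the integral is positive, whereas a nonintegrable function would have
    -- integral 0 by convention.
    by_contra hn
    rw [integral_undef hn] at h
    have : 0 < Real.Gamma ((((a + b : ℕ) : ℝ) + 2) / 2) :=
      Real.Gamma_pos_of_pos (by positivity)
    have hpi := Real.pi_pos
    have : 0 < 2 * Real.pi / 2 * Real.Gamma ((((a + b : ℕ) : ℝ) + 2) / 2) := by positivity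
    exact this.ne h
  refine hint.mono' (Continuous.aestronglyMeasurable (by fun_prop)) (.of_forall fun z => ?_)
  simp only [norm_mul, norm_pow, norm_star, Complex.norm_real, Real.rpow_natCast, Real.rpow_two,
    pow_add, Real.norm_eq_abs, Real.abs_exp]
  exact le_rfl

end GaussianMoments

/-! ### Gaussian integration of polynomials. -/

section GaussianFunctional

variable {ι : Type*} [Fintype ι]

/-- The Gaussian weight `exp (-∑ |z i|²)`. -/
def gaussWeight (z : ι → ℂ) : ℂ := ∏ i, (Real.exp (-‖z i‖ ^ 2) : ℂ)

lemma evalStar_monomial (z : ι → ℂ) (s : ι ⊕ ι →₀ ℕ) (c : ℂ) :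
    evalStar z (monomial s c) =
      c * ∏ i, (z i ^ s (Sum.inl i) * star (z i) ^ s (Sum.inr i)) := by
  rw [evalStar, eval_monomial, Finsupp.prod_fintype _ _ (by simp), Fintype.prod_sum_type,
    Finset.prod_mul_distrib]
  rfl

lemma evalStar_monomial_mul_gaussWeight (z : ι → ℂ) (s : ι ⊕ ι →₀ ℕ) (c : ℂ) :
    evalStar z (monomial s c) * gaussWeight z =
      c * ∏ i, (z i ^ s (Sum.inl i) * star (z i) ^ s (Sum.inr i) *
        (Real.exp (-‖z i‖ ^ 2) : ℂ)) := by
  rw [evalStar_monomial, gaussWeight, mul_assoc, ← Finset.prod_mul_distrib]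

lemma integrable_evalStar_mul_gaussWeight (P : MvPolynomial (ι ⊕ ι) ℂ) :
    Integrable fun z : ι → ℂ => evalStar z P * gaussWeight z := by
  induction P using MvPolynomial.induction_on' with
  | monomial s c =>
    simp only [evalStar_monomial_mul_gaussWeight]
    exact (Integrable.fintype_prod (μ := fun _ => volume) (f := fun i w => w ^ s (Sum.inl i) *
      star w ^ s (Sum.inr i) * (Real.exp (-‖w‖ ^ 2) : ℂ))
        fun i => integrable_gaussMoment _ _).const_mul c
  | add P R hP hR =>
    simp only [map_add, add_mul]
    exact hP.add hR

/-- Integration against the Gaussian weight. -/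
def gaussFunctional : MvPolynomial (ι ⊕ ι) ℂ →ₗ[ℂ] ℂ where
  toFun P := ∫ z : ι → ℂ, evalStar z P * gaussWeight z
  map_add' P R := by
    rw [← integral_add (integrable_evalStar_mul_gaussWeight P)
      (integrable_evalStar_mul_gaussWeight R)]
    simp [add_mul]
  map_smul' c P := by
    rw [RingHom.id_apply, smul_eq_mul, ← integral_const_mul]
    simp [evalStar, smul_eval, mul_assoc]

lemma gaussFunctional_monomial (s : ι ⊕ ι →₀ ℕ) (c : ℂ) :
    gaussFunctional (monomial s c) =
      c * ∏ i, gaussMoment (s (Sum.inl i)) (s (Sum.inr i)) := by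
  change ∫ z : ι → ℂ, evalStar z (monomial s c) * gaussWeight z = _
  simp only [evalStar_monomial_mul_gaussWeight]
  rw [integral_const_mul, integral_fintype_prod_volume_eq_prod (f := fun i w =>
    w ^ s (Sum.inl i) * star w ^ s (Sum.inr i) * (Real.exp (-‖w‖ ^ 2) : ℂ))]
  rfl

/-- Gaussian integration by parts. -/
lemma gaussFunctional_pderiv_inl (i : ι) (P : MvPolynomial (ι ⊕ ι) ℂ) :
    gaussFunctional (pderiv (Sum.inl i) P) = gaussFunctional (X (Sum.inr i) * P) := by
  classical
  induction P using MvPolynomial.induction_on' with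
  | monomial s c =>
    rw [pderiv_monomial, X, monomial_mul, gaussFunctional_monomial, gaussFunctional_monomial,
      ← Finset.mul_prod_erase _ _ (Finset.mem_univ i),
      ← Finset.mul_prod_erase (f := fun j => gaussMoment
        ((Finsupp.single (Sum.inr i) 1 + s : ι ⊕ ι →₀ ℕ) (Sum.inl j))
        ((Finsupp.single (Sum.inr i) 1 + s : ι ⊕ ι →₀ ℕ) (Sum.inr j))) _ (Finset.mem_univ i)]
    have h1 : gaussMoment ((Finsupp.single (Sum.inr i) 1 + s : ι ⊕ ι →₀ ℕ) (Sum.inl i))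
        ((Finsupp.single (Sum.inr i) 1 + s : ι ⊕ ι →₀ ℕ) (Sum.inr i)) =
        s (Sum.inl i) * gaussMoment (s (Sum.inl i) - 1) (s (Sum.inr i)) := by
      simp [add_comm 1, gaussMoment_succ_right]
    rw [h1, one_mul]
    simp only [Finsupp.tsub_apply, Finsupp.single_eq_same, Finsupp.single_apply, Finsupp.add_apply,
      Sum.inl.injEq, Sum.inr.injEq, reduceCtorEq, if_false, tsub_zero, zero_add]
    rw [mul_assoc, mul_assoc]
    congr 3
    refine Finset.prod_congr rfl fun j hj => ?_
    simp [(Finset.ne_of_mem_erase hj).symm]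
  | add P R hP hR => simp [mul_add, hP, hR]

lemma gaussFunctional_pderiv_inr (i : ι) (P : MvPolynomial (ι ⊕ ι) ℂ) :
    gaussFunctional (pderiv (Sum.inr i) P) = gaussFunctional (X (Sum.inl i) * P) := by
  classical
  induction P using MvPolynomial.induction_on' with
  | monomial s c =>
    rw [pderiv_monomial, X, monomial_mul, gaussFunctional_monomial, gaussFunctional_monomial,
      ← Finset.mul_prod_erase _ _ (Finset.mem_univ i),
      ← Finset.mul_prod_erase (f := fun j => gaussMoment
        ((Finsupp.single (Sum.inl i) 1 + s : ι ⊕ ι →₀ ℕ) (Sum.inl j))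
        ((Finsupp.single (Sum.inl i) 1 + s : ι ⊕ ι →₀ ℕ) (Sum.inr j))) _ (Finset.mem_univ i)]
    have h1 : gaussMoment ((Finsupp.single (Sum.inl i) 1 + s : ι ⊕ ι →₀ ℕ) (Sum.inl i))
        ((Finsupp.single (Sum.inl i) 1 + s : ι ⊕ ι →₀ ℕ) (Sum.inr i)) =
        s (Sum.inr i) * gaussMoment (s (Sum.inl i)) (s (Sum.inr i) - 1) := by
      simp [add_comm 1, gaussMoment_succ_left]
    rw [h1, one_mul]
    simp only [Finsupp.tsub_apply, Finsupp.single_eq_same, Finsupp.single_apply, Finsupp.add_apply,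
      Sum.inl.injEq, Sum.inr.injEq, reduceCtorEq, if_false, tsub_zero, zero_add]
    rw [mul_assoc, mul_assoc]
    congr 3
    refine Finset.prod_congr rfl fun j hj => ?_
    simp [(Finset.ne_of_mem_erase hj).symm]
  | add P R hP hR => simp [mul_add, hP, hR]

lemma pderiv_comm {σ : Type*} (i j : σ) (P : MvPolynomial σ ℂ) :
    pderiv i (pderiv j P) = pderiv j (pderiv i P) := by
  classical
  ext s
  simp only [coeff_pderiv, Finsupp.add_apply, Finsupp.single_apply]
  by_cases h : i = j
  · subst h; rfl
  · rw [add_right_comm]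
    simp only [h, Ne.symm h, if_false]
    ring_nf

/-- Harmonic bihomogeneous polynomials of positive degree have vanishing Gaussian integral. -/
lemma gaussFunctional_eq_zero_of_harmonic {P : MvPolynomial (ι ⊕ ι) ℂ} {p q : ℕ}
    (hP : IsBihomogeneous P p q) (hD : complexLaplacian P = 0) (hpq : (p, q) ≠ (0, 0)) :
    gaussFunctional P = 0 := by
  -- By Euler's identity q P = ∑ y_i ∂_{y_i} P, and integration by parts turns the factor y_i into
  -- ∂_{x_i}, so the integral becomes that of the Laplacian of P. The same argument with the
  -- variables exchanged handles p.
  have hq : (q : ℂ) * gaussFunctional P = 0 := by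
    rw [← smul_eq_mul, ← map_smul, ← hP.sum_X_mul_pderiv_inr, map_sum,
      ← map_zero (gaussFunctional (ι := ι)), ← hD, complexLaplacian_apply, map_sum]
    exact Finset.sum_congr rfl fun i _ => (gaussFunctional_pderiv_inl i _).symm
  have hp : (p : ℂ) * gaussFunctional P = 0 := by
    rw [← smul_eq_mul, ← map_smul, ← hP.sum_X_mul_pderiv_inl, map_sum,
      ← map_zero (gaussFunctional (ι := ι)), ← hD, complexLaplacian_apply, map_sum]
    refine Finset.sum_congr rfl fun i _ => ?_
    rw [← gaussFunctional_pderiv_inr, pderiv_comm]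
  simp only [ne_eq, Prod.mk.injEq, not_and_or] at hpq
  rcases hpq with h | h
  · exact (mul_eq_zero.1 hp).resolve_left (by exact_mod_cast h)
  · exact (mul_eq_zero.1 hq).resolve_left (by exact_mod_cast h)

end GaussianFunctional

end

noncomputable section

open MvPolynomial

/-! ### Polar coordinates and means over the sphere. -/

section SphereMeasure

instance (n : ℕ) : IsFiniteMeasure (sphereMeasure n) := by
  unfold sphereMeasure; infer_instance

variable {n : ℕ}

/-- The coordinates of a point of the sphere. -/
def sphereCoord (ζ : CSphere n) : Fin (n + 1) → ℂ := (ζ : CSpace n).ofLp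

lemma continuous_sphereCoord : Continuous (sphereCoord (n := n)) :=
  (PiLp.continuous_ofLp 2 _).comp continuous_subtype_val

lemma hdot_eq (ζ η : CSphere n) :
    hdot ζ η = ∑ i, sphereCoord ζ i * star (sphereCoord η i) := rfl

lemma hdot_eq_inner (ζ η : CSphere n) : hdot ζ η = inner ℂ (η : CSpace n) (ζ : CSpace n) := rfl

lemma sum_sphereCoord_mul_star (ζ : CSphere n) :
    ∑ i, sphereCoord ζ i * star (sphereCoord ζ i) = 1 := by
  rw [← hdot_eq, hdot_eq_inner, inner_self_eq_norm_sq_to_K, norm_eq_of_mem_sphere]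
  simp

lemma evalStar_smul {ι : Type*} [Fintype ι] {P : MvPolynomial (ι ⊕ ι) ℂ} {d : ℕ}
    (hP : P.IsHomogeneous d) (r : ℝ) (z : ι → ℂ) :
    evalStar ((r : ℂ) • z) P = (r : ℂ) ^ d * evalStar z P := by
  have : Sum.elim ((r : ℂ) • z) (star ((r : ℂ) • z)) = (r : ℂ) • Sum.elim z (star z) := by
    ext (i | i) <;> simp
  rw [evalStar, evalStar, this, eval_eq', eval_eq', Finset.mul_sum]
  refine Finset.sum_congr rfl fun s hs => ?_
  have hd := hP (mem_support_iff.1 hs)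
  rw [Finsupp.weight_apply, Finsupp.sum_fintype _ _ (by simp)] at hd
  simp only [Pi.smul_apply, smul_eq_mul, mul_pow, Finset.prod_mul_distrib,
    Finset.prod_pow_eq_pow_sum]
  rw [← hd]
  simp
  ring

/-- Integration in polar coordinates of a function that factors. -/
lemma integral_polar (g : CSphere n → ℂ) (φ : ℝ → ℂ) (F : CSpace n → ℂ)
    (hF : ∀ (ζ : CSphere n) (r : ℝ), 0 < r → F (r • (ζ : CSpace n)) = g ζ * φ r) :
    ∫ x, F x = (∫ ζ, g ζ ∂sphereMeasure n) *
      ∫ r : Set.Ioi (0 : ℝ), φ r ∂Measure.volumeIoiPow (Module.finrank ℝ (CSpace n) - 1) := by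
  have h := (volume : Measure (CSpace n)).measurePreserving_homeomorphUnitSphereProd
  have h2 := h.integral_comp (Homeomorph.measurableEmbedding _)
    (fun p : CSphere n × Set.Ioi (0 : ℝ) => g p.1 * φ p.2)
  rw [integral_prod_mul g (fun r : Set.Ioi (0 : ℝ) => φ r)] at h2
  have h3 : ∫ x, F x = ∫ x : ({0}ᶜ : Set (CSpace n)), F x ∂Measure.comap Subtype.val volume := by
    rw [integral_subtype_comap (measurableSet_singleton _).compl F, restrict_compl_singleton]
  rw [sphereMeasure, ← h2, h3]
  refine integral_congr_ae (.of_forall fun x => ?_)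
  have hx := (homeomorphUnitSphereProd (CSpace n)).symm_apply_apply x
  set y := homeomorphUnitSphereProd (CSpace n) x
  change F x = g y.1 * φ y.2
  rw [← hF y.1 y.2 y.2.2, ← hx]
  rfl

/-- By homogeneity the Gaussian integral is the spherical integral times a radial one, and the
radial factor is nonzero. -/
lemma integral_evalStar_sphere (P : MvPolynomial (Fin (n + 1) ⊕ Fin (n + 1)) ℂ) {d : ℕ}
    (hP : P.IsHomogeneous d) (h0 : gaussFunctional P = 0) :
    ∫ ζ, evalStar (sphereCoord ζ) P ∂sphereMeasure n = 0 := by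
  have h1 := integral_polar (n := n) (fun ζ => evalStar (sphereCoord ζ) P)
    (fun r => (r : ℂ) ^ d * Real.exp (-r ^ 2))
    (fun x => evalStar x.ofLp P * gaussWeight x.ofLp) (by
      intro ζ r hr
      have e1 : (r • (ζ : CSpace n)).ofLp = (r : ℂ) • sphereCoord ζ := by
        ext i; simp [sphereCoord]
      have e2 : gaussWeight ((r : ℂ) • sphereCoord ζ) = Real.exp (-r ^ 2) := by
        have e3 : ∑ i, ‖sphereCoord ζ i‖ ^ 2 = 1 := by
          have := sum_sphereCoord_mul_star ζ
          simp only [RCLike.star_def, Complex.mul_conj, Complex.normSq_eq_norm_sq] at this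
          exact_mod_cast this
        rw [gaussWeight, ← Complex.ofReal_prod, ← Real.exp_sum]
        simp [mul_pow, ← Finset.mul_sum, e3]
      rw [e1, e2, evalStar_smul hP]
      ring)
  have h2 : ∫ x : CSpace n, evalStar x.ofLp P * gaussWeight x.ofLp = 0 := by
    let e : (Fin (n + 1) → ℂ) ≃L[ℝ] CSpace n := (PiLp.continuousLinearEquiv 2 ℝ _).symm
    have hH : (Measure.map e volume).IsAddHaarMeasure := e.isAddHaarMeasure_map volume
    -- Proportionality of the two Haar measures suffices, because the integral to be transported is
    -- zero.
    have hs := Measure.isAddLeftInvariant_eq_smul (volume : Measure (CSpace n))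
      (Measure.map e volume)
    have he : MeasurableEmbedding e := e.toHomeomorph.measurableEmbedding
    have : ∫ x : Fin (n + 1) → ℂ, evalStar x P * gaussWeight x = 0 := h0
    rw [hs, integral_smul_nnreal_measure, he.integral_map]
    exact (congrArg _ this).trans (smul_zero _)
  have h3 : ∫ x : CSpace n, ((‖x‖ : ℂ) ^ d * Real.exp (-‖x‖ ^ 2)) ≠ 0 := by
    rw [integral_fun_norm_addHaar volume (fun r : ℝ => ((r : ℂ) ^ d * Real.exp (-r ^ 2)))]
    have hg := integral_rpow_mul_exp_neg_rpow (p := 2) (q := (Module.finrank ℝ (CSpace n) - 1 + d : ℕ))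
      (by norm_num) (by
        have : (0 : ℝ) ≤ (Module.finrank ℝ (CSpace n) - 1 + d : ℕ) := Nat.cast_nonneg _
        linarith)
    have hG : ∫ y in Set.Ioi (0 : ℝ), y ^ (Module.finrank ℝ (CSpace n) - 1) •
        ((y : ℂ) ^ d * Real.exp (-y ^ 2)) = ((∫ x in Set.Ioi (0 : ℝ),
          x ^ ((Module.finrank ℝ (CSpace n) - 1 + d : ℕ) : ℝ) * Real.exp (-x ^ (2 : ℝ)) : ℝ) : ℂ) := by
      rw [← integral_complex_ofReal]
      congr 1
      ext y
      rw [Real.rpow_natCast, Real.rpow_two, pow_add]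
      simp
      ring
    rw [hG, hg]
    have hΓ : 0 < Real.Gamma ((((Module.finrank ℝ (CSpace n) - 1 + d : ℕ) : ℝ) + 1) / 2) :=
      Real.Gamma_pos_of_pos (by positivity)
    have hv : (volume : Measure (CSpace n)).real (Metric.ball 0 1) ≠ 0 :=
      (ENNReal.toReal_pos (Metric.measure_ball_pos _ _ one_pos).ne' measure_ball_lt_top.ne).ne'
    have hd : Module.finrank ℝ (CSpace n) ≠ 0 := Module.finrank_pos.ne'
    simp only [nsmul_eq_mul, ne_eq, mul_eq_zero, smul_eq_zero, not_or]
    refine ⟨by exact_mod_cast hd, hv, ?_⟩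
    exact_mod_cast (by positivity : (0:ℝ) < 1 / 2 * Real.Gamma _).ne'
  -- The same radial factor occurs in the integral of |x|^d exp(-|x|²), whose value is nonzero; this
  -- excludes its vanishing.
  have h4 := integral_polar (n := n) (fun _ => 1)
    (fun r => (r : ℂ) ^ d * Real.exp (-r ^ 2))
    (fun x => ((‖x‖ : ℂ) ^ d * Real.exp (-‖x‖ ^ 2))) (by
      intro ζ r hr
      have : ‖r • (ζ : CSpace n)‖ = r := by
        rw [norm_smul, norm_eq_of_mem_sphere, mul_one, Real.norm_of_nonneg hr.le]
      rw [this, one_mul])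
  rw [h4] at h3
  rw [h2] at h1
  exact (mul_eq_zero.1 h1.symm).resolve_right (right_ne_zero_of_mul h3)

end SphereMeasure

end

noncomputable section

open MvPolynomial

/-! ### Continuous dependence of the harmonic parts on the pole. -/

section Continuity

variable {ι : Type*} [Fintype ι] {Y : Type*} [TopologicalSpace Y]

/-- A family of polynomials whose coefficients depend continuously on the parameter. -/
def ContinuousCoeff {σ : Type*} (φ : Y → MvPolynomial σ ℂ) : Prop :=
  ∀ s, Continuous fun y => coeff s (φ y)

namespace ContinuousCoeff

variable {σ : Type*} {φ ψ : Y → MvPolynomial σ ℂ}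

lemma const (P : MvPolynomial σ ℂ) : ContinuousCoeff fun _ : Y => P := fun _ => continuous_const

lemma mul (hφ : ContinuousCoeff φ) (hψ : ContinuousCoeff ψ) :
    ContinuousCoeff fun y => φ y * ψ y := fun s => by
  classical
  simp only [coeff_mul]
  exact continuous_finsetSum _ fun x _ => (hφ x.1).mul (hψ x.2)

lemma pow (hφ : ContinuousCoeff φ) (k : ℕ) : ContinuousCoeff fun y => φ y ^ k := by
  induction k with
  | zero => simpa using const 1
  | succ k ih => simpa only [pow_succ] using ih.mul hφ

lemma sub (hφ : ContinuousCoeff φ) (hψ : ContinuousCoeff ψ) :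
    ContinuousCoeff fun y => φ y - ψ y := fun s => by
  simp only [coeff_sub]
  exact (hφ s).sub (hψ s)

lemma sum {κ : Type*} {T : Finset κ} {φ : κ → Y → MvPolynomial σ ℂ}
    (h : ∀ i ∈ T, ContinuousCoeff (φ i)) : ContinuousCoeff fun y => ∑ i ∈ T, φ i y := fun s => by
  simp only [coeff_sum]
  exact continuous_finsetSum _ fun i hi => h i hi s

lemma smul {c : Y → ℂ} (hc : Continuous c) (hφ : ContinuousCoeff φ) :
    ContinuousCoeff fun y => c y • φ y := fun s => by
  simp only [coeff_smul]
  exact hc.smul (hφ s)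

lemma normMul_pow {φ : Y → MvPolynomial (ι ⊕ ι) ℂ} (hφ : ContinuousCoeff φ) (k : ℕ) :
    ContinuousCoeff fun y => (normMul ^ k) (φ y) := by
  induction k with
  | zero => simpa
  | succ k ih =>
    simp only [pow_succ', Module.End.mul_apply, normMul_apply]
    exact (const _).mul ih

lemma zonal (p q : ℕ) : ContinuousCoeff fun v : ι → ℂ => zonal v p q := by
  refine ContinuousCoeff.mul (ContinuousCoeff.pow ?_ p) (ContinuousCoeff.pow ?_ q)
  · exact ContinuousCoeff.sum fun i _ =>
      ContinuousCoeff.smul (continuous_star.comp (continuous_apply i)) (const _)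
  · exact ContinuousCoeff.sum fun i _ => ContinuousCoeff.smul (continuous_apply i) (const _)

lemma harmonicZonal (n p q : ℕ) : ContinuousCoeff fun v : ι → ℂ => harmonicZonal n v p q := by
  induction q using Nat.strong_induction_on generalizing p with
  | _ q ih =>
    have : (fun v : ι → ℂ => _root_.harmonicZonal n v p q) = fun v => _root_.zonal v p q -
        ∑ k ∈ Finset.range (min p q), primCoeff n p q (k + 1) •
          (normMul ^ (k + 1)) (_root_.harmonicZonal n v (p - (k + 1)) (q - (k + 1))) :=
      funext fun v => primPart_eq n normMul (_root_.zonal v) p q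
    rw [this]
    refine (ContinuousCoeff.zonal p q).sub (ContinuousCoeff.sum fun k hk => ?_)
    rw [Finset.mem_range] at hk
    exact ContinuousCoeff.smul continuous_const ((ih _ (by omega) _).normMul_pow _)

end ContinuousCoeff

end Continuity

/-! ### Harmonic energies and moments of a function on the sphere. -/

section Energy

variable {n : ℕ}

/-- The pairing of `f` with a coefficient of the harmonic zonal polynomial. -/
def harmonicMoment (f : CSphere n → ℂ) (p q : ℕ)
    (s : Fin (n + 1) ⊕ Fin (n + 1) →₀ ℕ) : ℂ :=
  ∫ η, coeff s (harmonicZonal n (sphereCoord η) p q) * f η ∂sphereMeasure n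

/-- The squared norm (suitably normalised) of the harmonic component of `f` of bidegree
`(p, q)`. -/
def harmonicEnergy (f : CSphere n → ℂ) (p q : ℕ) : ℝ :=
  (p + q + n).factorial / ((p.factorial * q.factorial) ^ 2 : ℕ) *
    ∑ s ∈ Finset.univ.finsuppAntidiag (p + q),
      (multiFactorial s : ℝ) * ‖harmonicMoment f p q s‖ ^ 2

lemma harmonicEnergy_nonneg (f : CSphere n → ℂ) (p q : ℕ) : 0 ≤ harmonicEnergy f p q :=
  mul_nonneg (by positivity) (Finset.sum_nonneg fun _ _ => by positivity)

lemma coeff_eq_zero_of_notMem_antidiag {ι : Type*} [Fintype ι] [DecidableEq ι]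
    {P : MvPolynomial (ι ⊕ ι) ℂ} {p q : ℕ} (hP : IsBihomogeneous P p q) {s : ι ⊕ ι →₀ ℕ}
    (hs : s ∉ Finset.univ.finsuppAntidiag (p + q)) : coeff s P = 0 := by
  by_contra h
  have := hP.isHomogeneous h
  rw [Finsupp.weight_apply, Finsupp.sum_fintype _ _ (by simp)] at this
  exact hs (Finset.mem_finsuppAntidiag.2 ⟨by simpa using this, Finset.subset_univ _⟩)

lemma harmonicKernel_eq_sum {ι : Type*} [Fintype ι] [DecidableEq ι] (p q : ℕ) (u v : ι → ℂ) :
    harmonicKernel n p q u v = (p + q + n).factorial / ((p.factorial * q.factorial) ^ 2 : ℕ) *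
      ∑ s ∈ Finset.univ.finsuppAntidiag (p + q), (multiFactorial s : ℂ) *
        (star (coeff s (harmonicZonal n u p q)) * coeff s (harmonicZonal n v p q)) := by
  rw [harmonicKernel, fischer_eq_sum]
  intro s hs
  by_contra h
  exact (mem_support_iff.1 hs)
    (coeff_eq_zero_of_notMem_antidiag (isBihomogeneous_harmonicZonal n u p q) h)

lemma continuous_coeff_harmonicZonal (p q : ℕ) (s : Fin (n + 1) ⊕ Fin (n + 1) →₀ ℕ) :
    Continuous fun η : CSphere n => coeff s (harmonicZonal n (sphereCoord η) p q) :=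
  (ContinuousCoeff.harmonicZonal n p q s).comp continuous_sphereCoord

lemma _root_.MeasureTheory.Integrable.continuous_mul {f : CSphere n → ℂ}
    (hf : Integrable f (sphereMeasure n)) {a : CSphere n → ℂ} (ha : Continuous a) :
    Integrable (fun η => a η * f η) (sphereMeasure n) := by
  obtain ⟨C, hC⟩ := isCompact_univ.exists_bound_of_continuousOn ha.continuousOn
  exact hf.bdd_mul ha.aestronglyMeasurable (.of_forall fun η => hC η trivial)

variable {f : CSphere n → ℂ}

/-- The Fischer form writes the kernel as a finite sum, with positive weights, of conj (a ζ) * a η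
with a continuous. The double integral of each summand is therefore a squared modulus. -/
lemma quadForm_harmonicKernel (hf : Integrable f (sphereMeasure n)) (p q : ℕ) :
    QuadFormConverges (fun ζ η => harmonicKernel n p q (sphereCoord ζ) (sphereCoord η)) f ∧
    quadForm (fun ζ η => harmonicKernel n p q (sphereCoord ζ) (sphereCoord η)) f =
      harmonicEnergy f p q := by
  have hg (s) := hf.continuous_mul (continuous_coeff_harmonicZonal p q s)
  have hg' (s) : Integrable (fun ζ => star (coeff s (harmonicZonal n (sphereCoord ζ) p q) * f ζ))
      (sphereMeasure n) := Complex.conjCLE.toContinuousLinearMap.integrable_comp (hg s)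
  have hI (s) := ((hg' s).mul_prod (hg s)).const_mul (multiFactorial s : ℂ)
  have hker : (fun z : CSphere n × CSphere n => star (f z.1) *
      harmonicKernel n p q (sphereCoord z.1) (sphereCoord z.2) * f z.2) =
      fun z => ((p + q + n).factorial / ((p.factorial * q.factorial) ^ 2 : ℕ) : ℂ) *
        ∑ s ∈ Finset.univ.finsuppAntidiag (p + q), (multiFactorial s : ℂ) *
        (star (coeff s (harmonicZonal n (sphereCoord z.1) p q) * f z.1) *
          (coeff s (harmonicZonal n (sphereCoord z.2) p q) * f z.2)) := by
    ext z
    rw [harmonicKernel_eq_sum, Finset.mul_sum, Finset.mul_sum, Finset.mul_sum, Finset.sum_mul]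
    refine Finset.sum_congr rfl fun s _ => ?_
    rw [star_mul']
    ring
  constructor
  · unfold QuadFormConverges
    rw [hker]
    exact (integrable_finsetSum _ fun s _ => hI s).const_mul _
  · unfold quadForm
    rw [hker, integral_const_mul, integral_finsetSum _ fun s _ => hI s]
    rw [harmonicEnergy]
    push_cast
    congr 1
    refine Finset.sum_congr rfl fun s _ => ?_
    rw [integral_const_mul]
    congr 1
    rw [integral_prod_mul (fun ζ => star (coeff s (harmonicZonal n (sphereCoord ζ) p q) * f ζ))
      (fun η => coeff s (harmonicZonal n (sphereCoord η) p q) * f η)]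
    have : ∫ ζ, star (coeff s (harmonicZonal n (sphereCoord ζ) p q) * f ζ) ∂sphereMeasure n =
        star (harmonicMoment f p q s) := integral_conj
    rw [this, ← harmonicMoment, mul_comm, RCLike.star_def, Complex.mul_conj,
      Complex.normSq_eq_norm_sq]
    push_cast
    rfl

/-- The coefficient of the harmonic component of bidegree `(p - k, q - k)` in
`w ^ p * w̄ ^ q`. -/
def zonalCoeff (n p q k : ℕ) : ℝ :=
  p.factorial * q.factorial / (k.factorial * (p + q - k + n).factorial)

lemma hdot_pow_eq_sum (ζ η : CSphere n) (p q : ℕ) :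
    hdot ζ η ^ p * star (hdot ζ η) ^ q = ∑ k ∈ Finset.range (min p q + 1),
      (zonalCoeff n p q k : ℂ) *
        harmonicKernel n (p - k) (q - k) (sphereCoord ζ) (sphereCoord η) := by
  rw [hdot_eq, pow_mul_star_pow_eq_sum (Fintype.card_fin _) (sum_sphereCoord_mul_star ζ)
    (sum_sphereCoord_mul_star η)]
  refine Finset.sum_congr rfl fun k _ => ?_
  rw [zonalCoeff]
  push_cast
  rfl

/-- The moments of `f` in terms of its harmonic energies. -/
def zonalMoment (f : CSphere n → ℂ) (p q : ℕ) : ℝ :=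
  ∑ k ∈ Finset.range (min p q + 1), zonalCoeff n p q k * harmonicEnergy f (p - k) (q - k)

lemma quadForm_hdot_pow (hf : Integrable f (sphereMeasure n)) (p q : ℕ) :
    quadForm (fun ζ η => hdot ζ η ^ p * star (hdot ζ η) ^ q) f = zonalMoment f p q := by
  have hI (k : ℕ) := (quadForm_harmonicKernel hf (p - k) (q - k)).1.const_mul
    (zonalCoeff n p q k : ℂ)
  have hE (k : ℕ) := (quadForm_harmonicKernel hf (p - k) (q - k)).2
  unfold quadForm at hE ⊢
  have : (fun z : CSphere n × CSphere n => star (f z.1) *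
      (hdot z.1 z.2 ^ p * star (hdot z.1 z.2) ^ q) * f z.2) =
      fun z => ∑ k ∈ Finset.range (min p q + 1), (zonalCoeff n p q k : ℂ) *
        (star (f z.1) * harmonicKernel n (p - k) (q - k) (sphereCoord z.1) (sphereCoord z.2) *
          f z.2) := by
    ext z
    rw [hdot_pow_eq_sum, Finset.mul_sum, Finset.sum_mul]
    exact Finset.sum_congr rfl fun k _ => by ring
  rw [this, integral_finsetSum _ fun k _ => hI k, zonalMoment]
  push_cast
  refine Finset.sum_congr rfl fun k _ => ?_
  rw [integral_const_mul, hE]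

/-- For fixed η the kernel is a harmonic polynomial of positive degree in ζ, so its integral over ζ
vanishes. -/
lemma harmonicEnergy_const (c : ℂ) {p q : ℕ} (hpq : (p, q) ≠ (0, 0)) :
    harmonicEnergy (fun _ : CSphere n => c) p q = 0 := by
  obtain ⟨h1, h2⟩ := quadForm_harmonicKernel
    (integrable_const c : Integrable (fun _ : CSphere n => c) (sphereMeasure n)) p q
  unfold QuadFormConverges at h1
  unfold quadForm at h2
  rw [integral_prod_symm _ h1] at h2
  have : ∀ η : CSphere n, ∫ ζ, star c * harmonicKernel n p q (sphereCoord ζ) (sphereCoord η) * c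
      ∂sphereMeasure n = 0 := by
    intro η
    simp only [harmonicKernel_eq_eval (Fintype.card_fin _) (sum_sphereCoord_mul_star η)]
    have hh := isBihomogeneous_harmonicZonal n (sphereCoord η) p q
    rw [integral_mul_const, integral_const_mul, integral_const_mul,
      integral_evalStar_sphere _ hh.isHomogeneous (gaussFunctional_eq_zero_of_harmonic hh
        (complexLaplacian_harmonicZonal (Fintype.card_fin _) (sum_sphereCoord_mul_star η) p q) hpq)]
    simp
  simp only [this, integral_zero] at h2
  exact_mod_cast h2.symm

lemma harmonicMoment_eq_zero {p q : ℕ} (h : harmonicEnergy f p q = 0)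
    (s : Fin (n + 1) ⊕ Fin (n + 1) →₀ ℕ) : harmonicMoment f p q s = 0 := by
  by_cases hs : s ∈ Finset.univ.finsuppAntidiag (p + q)
  · have h0 := (mul_eq_zero.1 h).resolve_left (by positivity)
    rw [Finset.sum_eq_zero_iff_of_nonneg fun _ _ => by positivity] at h0
    have hm : (multiFactorial s : ℝ) ≠ 0 := by
      exact_mod_cast Finset.prod_ne_zero_iff.2 fun i _ => Nat.factorial_ne_zero _
    simpa [hm] using h0 s hs
  · simp [harmonicMoment, coeff_eq_zero_of_notMem_antidiag
      (isBihomogeneous_harmonicZonal n _ p q) hs]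

/-- If all nonconstant harmonic components of `f` vanish, then `f` minus its mean has vanishing
moments. -/
lemma exists_integral_hdot_pow_eq_zero (hf : Integrable f (sphereMeasure n))
    (h : ∀ p q, (p, q) ≠ (0, 0) → harmonicEnergy f p q = 0) :
    ∃ c : ℂ, ∀ (ζ : CSphere n) (p q : ℕ),
      ∫ η, hdot ζ η ^ p * star (hdot ζ η) ^ q * (f η - c) ∂sphereMeasure n = 0 := by
  obtain ⟨c, hc⟩ : ∃ c : ℂ, ∫ η, (f η - c) ∂sphereMeasure n = 0 := by
    refine ⟨((sphereMeasure n).real Set.univ : ℂ)⁻¹ * ∫ η, f η ∂sphereMeasure n, ?_⟩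
    have hne : (sphereMeasure n).real Set.univ ≠ 0 := by
      refine (ENNReal.toReal_pos ?_ (measure_ne_top _ _)).ne'
      rw [ne_eq, Measure.measure_univ_eq_zero]
      exact Measure.toSphere_ne_zero _
    have hne' : ((sphereMeasure n).real Set.univ : ℂ) ≠ 0 := by exact_mod_cast hne
    rw [integral_sub hf (integrable_const _), integral_const, Complex.real_smul,
      mul_inv_cancel_left₀ hne', sub_self]
  have hg : Integrable (fun η => f η - c) (sphereMeasure n) := hf.sub (integrable_const c)
  -- In bidegree (0, 0) the harmonic part is the constant 1 and the choice of c gives zero; in the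
  -- other bidegrees f and the constant c both have vanishing moments.
  have hm (p q s) : harmonicMoment (fun η => f η - c) p q s = 0 := by
    by_cases hpq : (p, q) = (0, 0)
    · obtain ⟨rfl, rfl⟩ := Prod.mk.inj hpq
      have : ∀ η : CSphere n, harmonicZonal n (sphereCoord η) 0 0 = 1 := fun η => by
        rw [harmonicZonal, primPart_eq]
        simp [zonal]
      simp only [harmonicMoment, this]
      rw [integral_const_mul, hc, mul_zero]
    · have h1 := harmonicMoment_eq_zero (h p q hpq) s
      have h2 := harmonicMoment_eq_zero (harmonicEnergy_const (n := n) c hpq) s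
      unfold harmonicMoment at h1 h2 ⊢
      simp only [mul_sub]
      have hcc := continuous_coeff_harmonicZonal (n := n) p q s
      rw [integral_sub (hf.continuous_mul hcc) ((integrable_const c).continuous_mul hcc), h1, h2,
        sub_zero]
  refine ⟨c, fun ζ p q => ?_⟩
  have hI (p q s) := hg.continuous_mul (continuous_coeff_harmonicZonal p q s)
  have hz (p q : ℕ) : Integrable (fun η =>
        harmonicKernel n p q (sphereCoord ζ) (sphereCoord η) * (f η - c)) (sphereMeasure n) ∧
      ∫ η, harmonicKernel n p q (sphereCoord ζ) (sphereCoord η) * (f η - c) ∂sphereMeasure n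
        = 0 := by
    have : (fun η : CSphere n =>
        harmonicKernel n p q (sphereCoord ζ) (sphereCoord η) * (f η - c)) = fun η =>
        ∑ s ∈ Finset.univ.finsuppAntidiag (p + q),
        ((p + q + n).factorial / ((p.factorial * q.factorial) ^ 2 : ℕ) * ((multiFactorial s : ℂ) *
        star (coeff s (harmonicZonal n (sphereCoord ζ) p q)))) *
          (coeff s (harmonicZonal n (sphereCoord η) p q) * (f η - c)) := by
      ext η
      rw [harmonicKernel_eq_sum, Finset.mul_sum, Finset.sum_mul]
      exact Finset.sum_congr rfl fun s _ => by ring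
    rw [this]
    refine ⟨integrable_finsetSum _ fun s _ => (hI p q s).const_mul _, ?_⟩
    rw [integral_finsetSum _ fun s _ => (hI p q s).const_mul _]
    refine Finset.sum_eq_zero fun s _ => ?_
    rw [integral_const_mul, ← harmonicMoment.eq_1 (fun η => f η - c), hm, mul_zero]
  simp only [hdot_pow_eq_sum, Finset.sum_mul, mul_assoc]
  rw [integral_finsetSum _ fun k _ => (hz _ _).1.const_mul _]
  refine Finset.sum_eq_zero fun k _ => ?_
  rw [integral_const_mul, (hz _ _).2, mul_zero]

end Energy

end

noncomputable section

/-! ### Uniqueness through the Fourier transform. -/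

section CharFun

variable {n : ℕ}

lemma norm_hdot_le_one (ζ η : CSphere n) : ‖hdot ζ η‖ ≤ 1 := by
  rw [hdot_eq_inner]
  refine (norm_inner_le_norm _ _).trans ?_
  rw [norm_eq_of_mem_sphere, norm_eq_of_mem_sphere, one_mul]

lemma continuous_hdot : Continuous fun z : CSphere n × CSphere n => hdot z.1 z.2 := by
  have h1 : Continuous fun z : CSphere n × CSphere n => sphereCoord z.1 :=
    continuous_sphereCoord.comp continuous_fst
  have h2 : Continuous fun z : CSphere n × CSphere n => sphereCoord z.2 :=
    continuous_sphereCoord.comp continuous_snd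
  exact continuous_finsetSum _ fun i _ => ((continuous_apply i).comp h1).mul
    (continuous_star.comp ((continuous_apply i).comp h2))

lemma continuous_hdot_right (ζ : CSphere n) : Continuous fun η => hdot ζ η :=
  continuous_hdot.comp (Continuous.prodMk_right ζ)

lemma inner_smul_sphere (r : ℝ) (ζ η : CSphere n) :
    inner ℝ (η : CSpace n) (r • (ζ : CSpace n)) = r * (hdot ζ η).re := by
  rw [real_inner_smul_right, hdot, PiLp.inner_apply, Complex.re_sum]
  rfl

/-- Integrable functions on the sphere with vanishing Fourier transform vanish. -/
lemma ae_eq_zero_of_fourier_real {u : CSphere n → ℝ} (hu : Integrable u (sphereMeasure n))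
    (h : ∀ x : CSpace n, ∫ η, Complex.exp ((inner ℝ (η : CSpace n) x : ℝ) * Complex.I) * (u η : ℂ)
      ∂sphereMeasure n = 0) : u =ᵐ[sphereMeasure n] 0 := by
  set μ := sphereMeasure n
  have hemb : MeasurableEmbedding ((↑) : CSphere n → CSpace n) :=
    MeasurableEmbedding.subtype_coe Metric.isClosed_sphere.measurableSet
  -- `ENNReal.ofReal` truncates at 0, so ν u and ν (-u) are the positive and negative parts of u as
  -- finite measures. Pushed to the ambient space they have equal characteristic functions, hence
  -- coincide.
  let ν (w : CSphere n → ℝ) : Measure (CSphere n) := μ.withDensity fun η => ENNReal.ofReal (w η)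
  have hfin (w : CSphere n → ℝ) (hw : Integrable w μ) : IsFiniteMeasure (ν w) :=
    isFiniteMeasure_withDensity_ofReal hw.2
  have hchar (w : CSphere n → ℝ) (hw : Integrable w μ) (x : CSpace n) :
      charFun ((ν w).map (↑)) x = ∫ η, Complex.exp ((inner ℝ (η : CSpace n) x : ℝ) * Complex.I) *
        ((max (w η) 0 : ℝ) : ℂ) ∂μ := by
    rw [charFun_apply, hemb.integral_map, integral_withDensity_eq_integral_toReal_smul₀
      hw.1.aemeasurable.ennreal_ofReal (by simp)]
    refine integral_congr_ae (.of_forall fun η => ?_)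
    simp only [ENNReal.toReal_ofReal', Complex.real_smul]
    rw [mul_comm]
  have hint (w : CSphere n → ℝ) (hw : Integrable w μ) (x : CSpace n) :
      Integrable (fun η : CSphere n => Complex.exp ((inner ℝ (η : CSpace n) x : ℝ) * Complex.I) *
        ((max (w η) 0 : ℝ) : ℂ)) μ :=
    Integrable.continuous_mul (f := fun η => ((max (w η) 0 : ℝ) : ℂ))
      (hw.pos_part.ofReal) (by fun_prop)
  have := hfin u hu
  have := hfin (-u) hu.neg
  have heq : (ν u).map ((↑) : CSphere n → CSpace n) = (ν (-u)).map (↑) := by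
    refine Measure.ext_of_charFun (funext fun x => ?_)
    rw [hchar u hu, hchar (-u) hu.neg, ← sub_eq_zero, ← integral_sub (hint u hu x)
      (hint (-u) hu.neg x), ← h x]
    refine integral_congr_ae (.of_forall fun η => ?_)
    simp only [Pi.neg_apply]
    rw [← mul_sub, ← Complex.ofReal_sub]
    congr 2
    rcases le_total (u η) 0 with h0 | h0
    · rw [max_eq_right h0, max_eq_left (by linarith)]; ring
    · rw [max_eq_left h0, max_eq_right (by linarith)]; ring
  have heq' : ν u = ν (-u) := by
    rw [← hemb.comap_map (ν u), heq, hemb.comap_map]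
  have hae := (withDensity_eq_iff hu.1.aemeasurable.ennreal_ofReal
    hu.neg.1.aemeasurable.ennreal_ofReal (by
      exact (hu.lintegral_lt_top).ne)).1 heq'
  filter_upwards [hae] with η hη
  have := congrArg ENNReal.toReal hη
  simp only [ENNReal.toReal_ofReal', Pi.neg_apply] at this
  rcases le_total (u η) 0 with h0 | h0
  · rw [max_eq_right h0, max_eq_left (by linarith)] at this
    simp only [Pi.zero_apply]; linarith
  · rw [max_eq_left h0, max_eq_right (by linarith)] at this
    simpa using this

/-- Half the sum of the transform at x and the conjugate of the transform at -x is the transform of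
the real part. The imaginary part is the real part of -i g. -/
lemma ae_eq_zero_of_fourier {g : CSphere n → ℂ} (hg : Integrable g (sphereMeasure n))
    (h : ∀ x : CSpace n, ∫ η, Complex.exp ((inner ℝ (η : CSpace n) x : ℝ) * Complex.I) * g η
      ∂sphereMeasure n = 0) : g =ᵐ[sphereMeasure n] 0 := by
  have hre (g : CSphere n → ℂ) (hg : Integrable g (sphereMeasure n))
      (h : ∀ x : CSpace n, ∫ η, Complex.exp ((inner ℝ (η : CSpace n) x : ℝ) * Complex.I) * g η
        ∂sphereMeasure n = 0) : (fun η => (g η).re) =ᵐ[sphereMeasure n] 0 := by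
    refine ae_eq_zero_of_fourier_real hg.re fun x => ?_
    have h1 := h x
    have h2 := congrArg (starRingEnd ℂ) (h (-x))
    rw [← integral_conj, map_zero] at h2
    have hi1 : Integrable (fun η : CSphere n =>
        Complex.exp ((inner ℝ (η : CSpace n) x : ℝ) * Complex.I) * g η) (sphereMeasure n) :=
      hg.continuous_mul (by fun_prop)
    have hi2 : Integrable (fun η : CSphere n => (starRingEnd ℂ)
        (Complex.exp ((inner ℝ (η : CSpace n) (-x) : ℝ) * Complex.I) * g η)) (sphereMeasure n) :=
      Complex.conjCLE.toContinuousLinearMap.integrable_comp (hg.continuous_mul (by fun_prop))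
    have h3 := integral_add hi1 hi2
    rw [h1, h2, add_zero] at h3
    have h4 := congrArg (fun c : ℂ => 1 / 2 * c) h3
    simp only [mul_zero] at h4
    rw [← integral_const_mul] at h4
    rw [← h4]
    refine integral_congr_ae (.of_forall fun η => ?_)
    simp only [map_mul, ← Complex.exp_conj, Complex.conj_I, inner_neg_right, Complex.ofReal_neg,
      map_neg, Complex.conj_ofReal, neg_mul_neg]
    rw [← mul_add, Complex.add_conj]
    push_cast
    ring
  have h1 := hre g hg h
  have h2 := hre (fun η => -Complex.I * g η) (hg.const_mul _) fun x => by
    rw [← mul_zero (-Complex.I), ← h x, ← integral_const_mul]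
    exact integral_congr_ae (.of_forall fun η => by ring)
  filter_upwards [h1, h2] with η e1 e2
  apply Complex.ext
  · exact e1
  · simpa using e2

/-- Since 2 Re w = w + w̄, the exponential is the series of (i r / 2)^d (w + w̄)^d / d!, and each
power expands into monomials w^p w̄^q that integrate to zero. The bound |w + w̄| ≤ 2 justifies
termwise integration. -/
lemma integral_exp_hdot_eq_zero {g : CSphere n → ℂ} (hg : Integrable g (sphereMeasure n))
    (ζ : CSphere n)
    (h : ∀ p q : ℕ, ∫ η, hdot ζ η ^ p * star (hdot ζ η) ^ q * g η ∂sphereMeasure n = 0) (r : ℝ) :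
    ∫ η, Complex.exp ((r * (hdot ζ η).re : ℝ) * Complex.I) * g η ∂sphereMeasure n = 0 := by
  have hc := continuous_hdot_right ζ
  have hpow (d : ℕ) : ∫ η, (hdot ζ η + star (hdot ζ η)) ^ d * g η ∂sphereMeasure n = 0 := by
    simp only [add_pow, Finset.sum_mul]
    rw [integral_finsetSum]
    · refine Finset.sum_eq_zero fun k _ => ?_
      rw [← zero_mul (d.choose k : ℂ), ← h k (d - k), ← integral_mul_const]
      exact integral_congr_ae (.of_forall fun η => by ring)
    · exact fun k _ => hg.continuous_mul (by fun_prop)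
  let F (d : ℕ) (η : CSphere n) : ℂ :=
    (r / 2 * Complex.I) ^ d / d.factorial * ((hdot ζ η + star (hdot ζ η)) ^ d * g η)
  have hF (d : ℕ) : Integrable (F d) (sphereMeasure n) :=
    (hg.continuous_mul (by fun_prop)).const_mul _
  have hbound (d : ℕ) (η : CSphere n) : ‖F d η‖ ≤ |r| ^ d / d.factorial * ‖g η‖ := by
    have h1 : ‖hdot ζ η + star (hdot ζ η)‖ ≤ 2 := by
      refine (norm_add_le _ _).trans ?_
      rw [norm_star]
      linarith [norm_hdot_le_one ζ η]
    have h2 : ‖hdot ζ η + star (hdot ζ η)‖ ^ d ≤ 2 ^ d := by gcongr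
    calc ‖F d η‖ = (|r| / 2) ^ d / d.factorial * (‖hdot ζ η + star (hdot ζ η)‖ ^ d * ‖g η‖) := by
          simp [F]
      _ ≤ (|r| / 2) ^ d / d.factorial * (2 ^ d * ‖g η‖) := by gcongr
      _ = |r| ^ d / d.factorial * ‖g η‖ := by
          rw [div_pow]; field_simp
  have hsum : Summable fun d => ∫ η, ‖F d η‖ ∂sphereMeasure n := by
    refine Summable.of_nonneg_of_le (fun d => integral_nonneg fun _ => norm_nonneg _)
      (fun d => integral_mono (hF d).norm (hg.norm.const_mul _) (hbound d)) ?_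
    simp only [integral_const_mul]
    exact (Real.summable_pow_div_factorial _).mul_right _
  have key := hasSum_integral_of_summable_integral_norm hF hsum
  have hz : (fun d => ∫ η, F d η ∂sphereMeasure n) = fun _ => 0 := by
    ext d
    simp only [F]
    rw [integral_const_mul, hpow, mul_zero]
  rw [hz] at key
  rw [← key.unique hasSum_zero]
  refine integral_congr_ae (.of_forall fun η => ?_)
  have hexp := NormedSpace.expSeries_div_hasSum_exp (𝔸 := ℂ)
    ((r * (hdot ζ η).re : ℝ) * Complex.I)
  rw [← Complex.exp_eq_exp_ℂ] at hexp
  have := hexp.mul_right (g η)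
  refine this.tsum_eq.symm.trans ?_
  refine tsum_congr fun d => ?_
  simp only [F]
  rw [RCLike.star_def, Complex.add_conj, div_mul_eq_mul_div, div_mul_eq_mul_div, ← mul_assoc,
    ← mul_pow]
  congr 3
  push_cast
  ring

/-- A function all of whose nonconstant harmonic components vanish is constant. -/
lemma ae_const_of_harmonicEnergy_eq_zero {f : CSphere n → ℂ}
    (hf : Integrable f (sphereMeasure n))
    (h : ∀ p q, (p, q) ≠ (0, 0) → harmonicEnergy f p q = 0) :
    ∃ c : ℂ, ∀ᵐ ζ ∂sphereMeasure n, f ζ = c := by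
  obtain ⟨c, hc⟩ := exists_integral_hdot_pow_eq_zero hf h
  have hg : Integrable (fun η => f η - c) (sphereMeasure n) := hf.sub (integrable_const c)
  refine ⟨c, ?_⟩
  have := ae_eq_zero_of_fourier hg fun x => by
    -- Every frequency is a real multiple of a unit vector ζ, so the phase depends on η only through
    -- Re (ζ · η̄).
    obtain ⟨r, ζ, rfl⟩ : ∃ (r : ℝ) (ζ : CSphere n), x = r • (ζ : CSpace n) := by
      by_cases hx : x = 0
      · obtain ⟨ζ, hζ⟩ := NormedSpace.sphere_nonempty (E := CSpace n) (x := 0) (r := 1) |>.2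
          zero_le_one
        exact ⟨0, ⟨ζ, hζ⟩, by simp [hx]⟩
      · refine ⟨‖x‖, ⟨‖x‖⁻¹ • x, by simp [norm_smul, hx]⟩, ?_⟩
        simp [smul_smul, hx]
    simp only [inner_smul_sphere]
    exact integral_exp_hdot_eq_zero hg ζ (hc ζ) r
  filter_upwards [this] with η hη
  exact sub_eq_zero.1 hη

end CharFun

end

noncomputable section

/-! ### A contiguous relation for Gauss's series at 1. -/

section Contiguous

open Filter Topology

/-- A contiguous relation for Gauss's series at `1`: the sums of `(a)_l (b)_l / ((c)_l l!)` and
`(a - 1)_l (b)_l / ((c)_l l!)` have ratio `(c - a - b) / (c - a)`. -/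
lemma hasSum_contiguous {t : ℕ → ℝ} {a b c : ℝ} (ha : 0 < a) (hb : 0 < b) (ht0 : ∀ l, 0 ≤ t l)
    (hrec : ∀ l : ℕ, t (l + 1) * ((l + 1) * (c + l)) = (a + l) * (b + l) * t l)
    (ht : Summable t) :
    HasSum (fun l : ℕ => (c - a) * (if l = 0 then t 0 else (a - 1) / (a - 1 + l) * t l))
      ((c - a - b) * ∑' l, t l) := by
  -- The term l = 0 is set apart since its factor (a - 1) / (a - 1 + l) would be 0 / 0 at a = 1,
  -- where the limiting value 1 is wanted.
  set u : ℕ → ℝ := fun l => if l = 0 then t 0 else (a - 1) / (a - 1 + l) * t l with hu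
  -- The recursion for t makes (c-a) u - (c-a-b) t the difference sequence of v, so the claim is
  -- that v tends to 0.
  let v : ℕ → ℝ := fun l => (b + l - 1) * (if l = 0 then 0 else t (l - 1))
  have hstep (l : ℕ) : (c - a) * u l - (c - a - b) * t l = v (l + 1) - v l := by
    rcases l with _ | l
    · simp [u, v]; ring
    · have h1 : a - 1 + ((l : ℝ) + 1) ≠ 0 := by
        have : (0 : ℝ) ≤ l := l.cast_nonneg
        linarith
      have h2 := hrec l
      simp only [u, v, Nat.succ_ne_zero, if_false, Nat.add_sub_cancel]
      push_cast
      field_simp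
      linear_combination (-1 : ℝ) * h2
  have hus : Summable u := by
    rw [← summable_nat_add_iff 1]
    refine Summable.of_norm_bounded (g := fun l => |a - 1| / a * t (l + 1))
      (((summable_nat_add_iff 1).2 ht).mul_left _) fun l => ?_
    have h1 : a ≤ a - 1 + ((l : ℝ) + 1) := by
      have : (0 : ℝ) ≤ l := l.cast_nonneg
      linarith
    simp only [u, Nat.succ_ne_zero, if_false, norm_mul, norm_div, Real.norm_eq_abs]
    push_cast
    rw [abs_of_nonneg (ht0 _), abs_of_pos (ha.trans_le h1)]
    gcongr
    exact ht0 _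
  have hlim : Tendsto v atTop (𝓝 ((c - a) * (∑' l, u l) - (c - a - b) * ∑' l, t l)) := by
    have := ((hus.hasSum.mul_left (c - a)).sub (ht.hasSum.mul_left (c - a - b))).tendsto_sum_nat
    refine this.congr fun m => ?_
    rw [Finset.sum_congr rfl fun l _ => hstep l, Finset.sum_range_sub]
    simp [v]
  set L := (c - a) * (∑' l, u l) - (c - a - b) * ∑' l, t l with hL
  -- Here v (l+1) = (b+l) t l has a limit L ≥ 0. If L were positive, t would eventually dominate a
  -- multiple of 1 / (l+1), against its summability.
  have hL0 : L = 0 := by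
    have hv (l : ℕ) : v (l + 1) = (b + l) * t l := by simp [v]; left; ring
    have hlim' := hlim.comp (tendsto_add_atTop_nat 1)
    have hnn : 0 ≤ L := ge_of_tendsto' hlim' fun l => by
      simp only [Function.comp, hv]
      exact mul_nonneg (by positivity) (ht0 l)
    by_contra hne
    have hpos : 0 < L := lt_of_le_of_ne hnn (Ne.symm hne)
    have hev : ∀ᶠ l : ℕ in atTop, ‖(1 : ℝ) / (l + 1)‖ ≤ 2 * max b 1 / L * t l := by
      filter_upwards [hlim'.eventually (lt_mem_nhds (show L / 2 < L by linarith))] with l hl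
      simp only [Function.comp, hv] at hl
      rw [Real.norm_of_nonneg (by positivity), div_le_iff₀ (by positivity)]
      have h1 : b + l ≤ max b 1 * (l + 1) := by
        have h3 : (0 : ℝ) ≤ l := l.cast_nonneg
        nlinarith [le_max_left b 1, le_max_right b 1]
      have h2 : L / 2 ≤ max b 1 * (l + 1) * t l :=
        hl.le.trans (mul_le_mul_of_nonneg_right h1 (ht0 l))
      have : 2 * max b 1 / L * t l * (l + 1) = 2 / L * (max b 1 * (l + 1) * t l) := by ring
      rw [this]
      calc (1 : ℝ) = 2 / L * (L / 2) := by field_simp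
        _ ≤ _ := by gcongr
    have hsum : Summable fun l : ℕ => (1 : ℝ) / (l + 1) :=
      Summable.of_norm_bounded_eventually_nat (ht.mul_left _) hev
    refine Real.not_summable_one_div_natCast ?_
    rw [← summable_nat_add_iff 1]
    simpa using hsum
  have := hus.hasSum.mul_left (c - a)
  rwa [show (c - a) * ∑' l, u l = (c - a - b) * ∑' l, t l by linarith] at this

end Contiguous

/-! ### Eigenvalue series, their ratio and the comparison of A with B. -/

section Coefficients

/-- The binomial coefficients of `(1 - x) ^ (-α)`. -/
def negBinomCoeff (α : ℝ) : ℕ → ℝ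
  | 0 => 1
  | j + 1 => (α + j) / (j + 1) * negBinomCoeff α j

/-- The coefficients of `x * (1 - x) ^ (-α)`. -/
def shiftedCoeff (α : ℝ) : ℕ → ℝ
  | 0 => 0
  | j + 1 => negBinomCoeff α j

lemma negBinomCoeff_pos {α : ℝ} (hα : 0 < α) (j : ℕ) : 0 < negBinomCoeff α j := by
  induction j with
  | zero => simp [negBinomCoeff]
  | succ j ih => rw [negBinomCoeff]; positivity

lemma shiftedCoeff_eq {α : ℝ} (hα : 0 < α) (j : ℕ) :
    shiftedCoeff α j = j / (j - 1 + α) * negBinomCoeff α j := by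
  rcases j with _ | j
  · simp [shiftedCoeff]
  · rw [shiftedCoeff, negBinomCoeff]
    have : α + j ≠ 0 := by positivity
    push_cast
    rw [show ((j : ℝ) + 1 - 1 + α) = α + j by ring]
    field_simp

/-- The terms of the series for the eigenvalue of `|1 - w| ^ (-2α)` on bidegree `(p, q)`. -/
def kernelTerm (α : ℝ) (n p q k : ℕ) : ℝ :=
  negBinomCoeff α (p + k) * negBinomCoeff α (q + k) * zonalCoeff n (p + k) (q + k) k

lemma kernelTerm_pos {α : ℝ} (hα : 0 < α) (n p q k : ℕ) : 0 < kernelTerm α n p q k := by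
  have := negBinomCoeff_pos hα (p + k)
  have := negBinomCoeff_pos hα (q + k)
  unfold kernelTerm zonalCoeff
  positivity

/-- Up to a factor independent of k, these are the terms of Gauss's series with a = p+α, b = q+α, c
= p+q+n+1, so that c-a = q+n+1-α and c-a-b = n+1-2α. -/
lemma kernelTerm_succ {α : ℝ} (n p q k : ℕ) :
    kernelTerm α n p q (k + 1) * ((k + 1) * ((p + q + n + 1 : ℝ) + k)) =
      ((p + α) + k) * ((q + α) + k) * kernelTerm α n p q k := by
  unfold kernelTerm zonalCoeff
  rw [show p + (k + 1) + (q + (k + 1)) - (k + 1) + n = (p + q + k + n) + 1 by omega,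
    show p + k + (q + k) - k + n = p + q + k + n by omega, ← add_assoc, ← add_assoc]
  simp only [negBinomCoeff, Nat.factorial_succ]
  push_cast
  have h1 : ((p : ℝ) + k + 1) ≠ 0 := by positivity
  have h2 : ((q : ℝ) + k + 1) ≠ 0 := by positivity
  have h3 : ((k : ℝ) + 1) ≠ 0 := by positivity
  have h4 : ((p : ℝ) + q + k + n + 1) ≠ 0 := by positivity
  field_simp
  ring

lemma kernelTerm_symm (α : ℝ) (n p q k : ℕ) : kernelTerm α n p q k = kernelTerm α n q p k := by
  unfold kernelTerm zonalCoeff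
  rw [add_comm (p + k) (q + k)]
  ring

/-- The ratio of the eigenvalues of `|1 - w| ^ (-2α)` with exponents shifted by one. -/
def shiftRatio (α : ℝ) (p : ℕ) : ℝ := if p = 0 then 1 else (α - 1) / (p + α - 1)

lemma shiftRatio_le_one {α : ℝ} (hα : 0 < α) (p : ℕ) : shiftRatio α p ≤ 1 := by
  unfold shiftRatio
  split_ifs with h
  · exact le_rfl
  · have : (1 : ℝ) ≤ p := by exact_mod_cast Nat.one_le_iff_ne_zero.2 h
    rw [div_le_one (by linarith)]
    linarith

variable {α : ℝ} {n : ℕ}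

/-- Write m/(m-1+α) = 1 - (α-1)/(m-1+α) with m = p+k. The subtracted fraction is `shiftRatio α p`
times the factor (a-1)/(a-1+k) of the contiguous relation, with the value 1 prescribed at p = k = 0.
-/
lemma hasSum_shifted_kernelTerm (hα : 0 < α) (hαn : α < n + 1) {p q : ℕ}
    (ht : Summable (kernelTerm α n p q)) :
    HasSum (fun k : ℕ => ((p + k : ℕ) : ℝ) / ((p + k : ℕ) - 1 + α) * kernelTerm α n p q k)
      ((1 - (n + 1 - 2 * α) * (shiftRatio α p / (q + (n + 1 - α)))) *
        ∑' k, kernelTerm α n p q k) := by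
  have h := hasSum_contiguous (t := kernelTerm α n p q) (a := p + α) (b := q + α)
    (c := p + q + n + 1) (by positivity) (by positivity) (fun k => (kernelTerm_pos hα n p q k).le)
    (fun k => kernelTerm_succ n p q k) ht
  have hd : (q : ℝ) + (n + 1 - α) ≠ 0 := by
    have : (0 : ℝ) ≤ q := q.cast_nonneg
    linarith
  have h2 := ht.hasSum.sub (h.mul_left (shiftRatio α p / (q + (n + 1 - α))))
  have e1 (k : ℕ) : ((p + k : ℕ) : ℝ) / ((p + k : ℕ) - 1 + α) * kernelTerm α n p q k =
      kernelTerm α n p q k - shiftRatio α p / (q + (n + 1 - α)) *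
        ((p + q + n + 1 - (p + α)) * if k = 0 then kernelTerm α n p q 0
          else (p + α - 1) / (p + α - 1 + k) * kernelTerm α n p q k) := by
    rw [show (p : ℝ) + q + n + 1 - (p + α) = q + (n + 1 - α) by ring, ← mul_assoc,
      div_mul_cancel₀ _ hd]
    rcases k with _ | k
    · rcases p with _ | p
      · simp [shiftRatio]
      · have h1 : (p : ℝ) + α ≠ 0 := by positivity
        simp only [shiftRatio, Nat.succ_ne_zero, if_false, if_true, add_zero]
        push_cast
        rw [show (p : ℝ) + 1 - 1 + α = p + α by ring, show (p : ℝ) + 1 + α - 1 = p + α by ring]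
        field_simp
        ring
    · rcases p with _ | p
      · have h1 : (k : ℝ) + α ≠ 0 := by positivity
        simp only [shiftRatio, Nat.succ_ne_zero, if_false, if_true, zero_add]
        push_cast
        rw [show (k : ℝ) + 1 - 1 + α = k + α by ring,
          show (0 : ℝ) + α - 1 + (k + 1) = k + α by ring]
        field_simp
        ring
      · have h1 : (p : ℝ) + α ≠ 0 := by positivity
        have h2 : (p : ℝ) + α + k + 1 ≠ 0 := by positivity
        simp only [shiftRatio, Nat.succ_ne_zero, if_false]
        push_cast
        rw [show (p : ℝ) + 1 + (k + 1) - 1 + α = p + α + k + 1 by ring,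
          show (p : ℝ) + 1 + α - 1 + (k + 1) = p + α + k + 1 by ring,
          show (p : ℝ) + 1 + α - 1 = p + α by ring]
        field_simp
        ring
  have e2 : (1 - (n + 1 - 2 * α) * (shiftRatio α p / (q + (n + 1 - α)))) *
        ∑' k, kernelTerm α n p q k = ∑' k, kernelTerm α n p q k -
      shiftRatio α p / (q + (n + 1 - α)) *
        ((p + q + n + 1 - (p + α) - (q + α)) * ∑' k, kernelTerm α n p q k) := by ring
  simp only [e1]
  rw [e2]
  exact h2

/-- Ratio of the eigenvalues of the kernels of `A` and `B` on bidegree `(p, q)`. -/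
def eigenRatio (α : ℝ) (n p q : ℕ) : ℝ :=
  2 - (n + 1 - 2 * α) *
    (shiftRatio α p / (q + (n + 1 - α)) + shiftRatio α q / (p + (n + 1 - α)))

lemma eigenRatio_zero (hαn : α < n + 1) : eigenRatio α n 0 0 = 2 * α / (n + 1 - α) := by
  have : (n : ℝ) + 1 - α ≠ 0 := by linarith
  simp only [eigenRatio, shiftRatio, if_true, Nat.cast_zero, zero_add]
  field_simp
  ring

/-- Replacing both shift ratios by 1 and p, q by 0 can only increase the bracket that is multiplied
by n+1-2α > 0. A nonzero p or q makes one of the denominators strictly larger. -/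
lemma lt_eigenRatio (hα : 0 < α) (hα' : 2 * α < n + 1) {p q : ℕ} (hpq : (p, q) ≠ (0, 0)) :
    2 * α / (n + 1 - α) < eigenRatio α n p q := by
  have hd : 0 < (n : ℝ) + 1 - α := by linarith
  have hD : 0 < (n : ℝ) + 1 - 2 * α := by linarith
  have hle (p q : ℕ) : shiftRatio α p / (q + (n + 1 - α)) ≤ 1 / (q + (n + 1 - α)) := by
    gcongr
    exact shiftRatio_le_one hα p
  have hle' (q : ℕ) : 1 / (q + (n + 1 - α)) ≤ 1 / (n + 1 - α) := by
    gcongr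
    linarith [q.cast_nonneg (α := ℝ)]
  have hlt (q : ℕ) (hq : q ≠ 0) : 1 / (q + (n + 1 - α)) < 1 / (n + 1 - α) := by
    have : (0 : ℝ) < q := by exact_mod_cast Nat.pos_of_ne_zero hq
    gcongr
    linarith
  have key : shiftRatio α p / (q + (n + 1 - α)) + shiftRatio α q / (p + (n + 1 - α)) <
      1 / (n + 1 - α) + 1 / (n + 1 - α) := by
    simp only [ne_eq, Prod.mk.injEq, not_and_or] at hpq
    rcases hpq with h | h
    · exact add_lt_add_of_le_of_lt ((hle p q).trans (hle' q)) ((hle q p).trans_lt (hlt p h))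
    · exact add_lt_add_of_lt_of_le ((hle p q).trans_lt (hlt q h)) ((hle q p).trans (hle' p))
  have h0 : 2 * α / (n + 1 - α) = 2 - (n + 1 - 2 * α) * (1 / (n + 1 - α) + 1 / (n + 1 - α)) := by
    field_simp
    ring
  rw [h0, eigenRatio]
  have := mul_lt_mul_of_pos_left key hD
  linarith

/-- Reindexing of a double series by `(j, k) = (p + l, q + l)`. -/
lemma hasSum_diagonal {G : ℕ → ℕ → ℕ → ℝ} (hG : ∀ p q k, 0 ≤ G p q k) {B : ℝ}
    (h : HasSum (fun x : ℕ × ℕ => ∑ k ∈ Finset.range (min x.1 x.2 + 1),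
      G (x.1 - k) (x.2 - k) k) B) :
    HasSum (fun y : (ℕ × ℕ) × ℕ => G y.1.1 y.1.2 y.2) B := by
  -- With the first component a free variable it can be substituted, which avoids a heterogeneous
  -- equality between the `Fin` components.
  have aux : ∀ (x y : ℕ × ℕ) (_ : x = y) (l : ℕ) (hx : l < min x.1 x.2 + 1)
      (hy : l < min y.1 y.2 + 1),
      (⟨x, ⟨l, hx⟩⟩ : Σ x : ℕ × ℕ, Fin (min x.1 x.2 + 1)) = ⟨y, ⟨l, hy⟩⟩ := by
    rintro x _ rfl l _ _
    rfl
  let e : (Σ x : ℕ × ℕ, Fin (min x.1 x.2 + 1)) ≃ (ℕ × ℕ) × ℕ :=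
    { toFun := fun x => ((x.1.1 - x.2, x.1.2 - x.2), x.2)
      invFun := fun y => ⟨(y.1.1 + y.2, y.1.2 + y.2), ⟨y.2, by dsimp only; omega⟩⟩
      left_inv := by
        rintro ⟨⟨j, k⟩, l, hl⟩
        dsimp only at hl
        exact aux _ _ (by ext <;> simp only <;> omega) l _ hl
      right_inv := by
        rintro ⟨⟨p, q⟩, l⟩
        simp }
  rw [← e.hasSum_iff]
  have hfib (x : ℕ × ℕ) : HasSum (fun k : Fin (min x.1 x.2 + 1) => G (x.1 - k) (x.2 - k) k)
      (∑ k ∈ Finset.range (min x.1 x.2 + 1), G (x.1 - k) (x.2 - k) k) := by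
    rw [Finset.sum_range]
    exact hasSum_fintype _
  refine HasSum.sigma_of_hasSum h hfib ((summable_sigma_of_nonneg fun x => hG _ _ _).2
    ⟨fun x => (hfib x).summable, ?_⟩)
  exact h.summable.congr fun x => ((hfib x).tsum_eq).symm

/-- The comparison of the two forms, expressed through nonnegative harmonic energies. -/
lemma energy_comparison (hα : 0 < α) (hα' : 2 * α < n + 1) {E : ℕ → ℕ → ℝ}
    (hE : ∀ p q, 0 ≤ E p q) {A B : ℝ} {M : ℕ → ℕ → ℝ}
    (hM : ∀ p q, M p q =
      ∑ k ∈ Finset.range (min p q + 1), zonalCoeff n p q k * E (p - k) (q - k))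
    (hB : HasSum (fun x : ℕ × ℕ => negBinomCoeff α x.1 * negBinomCoeff α x.2 * M x.1 x.2) B)
    (hA : HasSum (fun x : ℕ × ℕ => (shiftedCoeff α x.1 * negBinomCoeff α x.2 +
      negBinomCoeff α x.1 * shiftedCoeff α x.2) * M x.1 x.2) A) :
    2 * α / (n + 1 - α) * B ≤ A ∧
      (A = 2 * α / (n + 1 - α) * B ↔ ∀ p q, (p, q) ≠ (0, 0) → E p q = 0) := by
  have hαn : α < n + 1 := by linarith
  let r (m : ℕ) : ℝ := m / (m - 1 + α)
  have hr (m : ℕ) : 0 ≤ r m := by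
    rcases m with _ | m
    · simp [r]
    · simp only [r]
      push_cast
      have : (0 : ℝ) ≤ m := m.cast_nonneg
      exact div_nonneg (by positivity) (by linarith)
  have hB' : HasSum (fun y : (ℕ × ℕ) × ℕ => kernelTerm α n y.1.1 y.1.2 y.2 * E y.1.1 y.1.2) B := by
    refine hasSum_diagonal (G := fun p q k => kernelTerm α n p q k * E p q)
      (fun p q k => mul_nonneg (kernelTerm_pos hα n p q k).le (hE p q)) ?_
    convert hB using 2 with x
    rw [hM, Finset.mul_sum]
    refine Finset.sum_congr rfl fun k hk => ?_
    rw [Finset.mem_range] at hk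
    rw [kernelTerm, Nat.sub_add_cancel (by omega), Nat.sub_add_cancel (by omega)]
    ring
  have hA' : HasSum (fun y : (ℕ × ℕ) × ℕ => (r (y.1.1 + y.2) + r (y.1.2 + y.2)) *
      kernelTerm α n y.1.1 y.1.2 y.2 * E y.1.1 y.1.2) A := by
    refine hasSum_diagonal (G := fun p q k => (r (p + k) + r (q + k)) * kernelTerm α n p q k * E p q)
      (fun p q k => mul_nonneg (mul_nonneg (add_nonneg (hr _) (hr _))
        (kernelTerm_pos hα n p q k).le) (hE p q)) ?_
    convert hA using 2 with x
    rw [hM, Finset.mul_sum]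
    refine Finset.sum_congr rfl fun k hk => ?_
    rw [Finset.mem_range] at hk
    rw [kernelTerm, Nat.sub_add_cancel (by omega), Nat.sub_add_cancel (by omega),
      shiftedCoeff_eq hα, shiftedCoeff_eq hα]
    ring
  let S (x : ℕ × ℕ) : ℝ := ∑' k, kernelTerm α n x.1 x.2 k
  -- Convergence of the eigenvalue series is inherited from the triple series wherever the energy is
  -- nonzero; elsewhere the value of S is irrelevant.
  have hsum (x : ℕ × ℕ) (hx : E x.1 x.2 ≠ 0) : Summable (kernelTerm α n x.1 x.2) := by
    have := hB'.summable.prod_factor x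
    exact (summable_mul_right_iff hx).1 this
  have hSB : HasSum (fun x : ℕ × ℕ => S x * E x.1 x.2) B := by
    refine hB'.prod_fiberwise fun x => ?_
    by_cases hx : E x.1 x.2 = 0
    · simp only [hx, mul_zero]; exact hasSum_zero
    · exact (hsum x hx).hasSum.mul_right _
  have hSA : HasSum (fun x : ℕ × ℕ => eigenRatio α n x.1 x.2 * S x * E x.1 x.2) A := by
    refine hA'.prod_fiberwise fun x => ?_
    by_cases hx : E x.1 x.2 = 0
    · simp only [hx, mul_zero]; exact hasSum_zero
    · refine HasSum.mul_right _ ?_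
      have h1 := hasSum_shifted_kernelTerm hα hαn (hsum x hx)
      have hsymm : kernelTerm α n x.2 x.1 = kernelTerm α n x.1 x.2 :=
        funext fun k => kernelTerm_symm α n _ _ k
      have h2 := hasSum_shifted_kernelTerm (p := x.2) (q := x.1) hα hαn (hsymm ▸ hsum x hx)
      rw [hsymm] at h2
      have e1 (k : ℕ) : (r (x.1 + k) + r (x.2 + k)) * kernelTerm α n x.1 x.2 k =
          ((x.1 + k : ℕ) : ℝ) / ((x.1 + k : ℕ) - 1 + α) * kernelTerm α n x.1 x.2 k +
          ((x.2 + k : ℕ) : ℝ) / ((x.2 + k : ℕ) - 1 + α) * kernelTerm α n x.1 x.2 k :=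
        add_mul _ _ _
      simp only [e1]
      have e2 : eigenRatio α n x.1 x.2 * S x =
          (1 - (n + 1 - 2 * α) * (shiftRatio α x.1 / (x.2 + (n + 1 - α)))) * S x +
          (1 - (n + 1 - 2 * α) * (shiftRatio α x.2 / (x.1 + (n + 1 - α)))) * S x := by
        rw [eigenRatio]; ring
      rw [e2]
      exact h1.add h2
  have hdiff : HasSum (fun x : ℕ × ℕ => (eigenRatio α n x.1 x.2 - 2 * α / (n + 1 - α)) * S x *
      E x.1 x.2) (A - 2 * α / (n + 1 - α) * B) := by
    have := hSA.sub (hSB.mul_left (2 * α / (n + 1 - α)))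
    have e (x : ℕ × ℕ) : (eigenRatio α n x.1 x.2 - 2 * α / (n + 1 - α)) * S x * E x.1 x.2 =
        eigenRatio α n x.1 x.2 * S x * E x.1 x.2 - 2 * α / (n + 1 - α) * (S x * E x.1 x.2) := by
      ring
    simp only [e]
    exact this
  have hS (x : ℕ × ℕ) : 0 ≤ S x := tsum_nonneg fun k => (kernelTerm_pos hα n _ _ k).le
  have hS' (x : ℕ × ℕ) (hx : E x.1 x.2 ≠ 0) : 0 < S x :=
    (hsum x hx).tsum_pos (fun k => (kernelTerm_pos hα n _ _ k).le) 0 (kernelTerm_pos hα n _ _ 0)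
  have hratio (x : ℕ × ℕ) : 0 ≤ eigenRatio α n x.1 x.2 - 2 * α / (n + 1 - α) := by
    by_cases hx : x = (0, 0)
    · subst hx
      rw [eigenRatio_zero hαn, sub_self]
    · exact sub_nonneg.2 (lt_eigenRatio hα hα' hx).le
  have hnn (x : ℕ × ℕ) :
      0 ≤ (eigenRatio α n x.1 x.2 - 2 * α / (n + 1 - α)) * S x * E x.1 x.2 :=
    mul_nonneg (mul_nonneg (hratio x) (hS x)) (hE _ _)
  refine ⟨sub_nonneg.1 (hdiff.nonneg hnn), ?_⟩
  rw [← sub_eq_zero]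
  constructor
  · intro h0 p q hpq
    rw [h0, hasSum_zero_iff_of_nonneg hnn] at hdiff
    by_contra hEpq
    have h1 := congrFun hdiff (p, q)
    have h2 := hS' (p, q) hEpq
    have h3 := sub_pos.2 (lt_eigenRatio (n := n) hα hα' hpq)
    exact (mul_ne_zero (mul_ne_zero h3.ne' h2.ne') hEpq) h1
  · intro h0
    refine hdiff.unique ?_
    have : (fun x : ℕ × ℕ => (eigenRatio α n x.1 x.2 - 2 * α / (n + 1 - α)) * S x *
      E x.1 x.2) = fun _ => 0 := by
      ext x
      by_cases hx : x = (0, 0)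
      · subst hx
        rw [eigenRatio_zero hαn, sub_self, zero_mul, zero_mul]
      · rw [h0 x.1 x.2 hx, mul_zero]
    rw [this]
    exact hasSum_zero

end Coefficients

end

noncomputable section

/-! ### Binomial expansion of the kernel. -/

section BinomialSeries

variable {α : ℝ}

lemma ringChoose_eq_negBinomCoeff (α : ℝ) (j : ℕ) :
    Ring.choose ((α : ℂ) + j - 1) j = negBinomCoeff α j := by
  have key (j : ℕ) : (j.factorial : ℂ) * Ring.choose ((α : ℂ) + j - 1) j =
      (ascPochhammer ℂ j).eval (α : ℂ) := by
    have := Ring.factorial_nsmul_multichoose_eq_ascPochhammer (α : ℂ) j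
    rw [Ring.multichoose_eq, nsmul_eq_mul, Polynomial.ascPochhammer_smeval_eq_eval] at this
    exact this
  have h2 (j : ℕ) : (j.factorial : ℂ) * negBinomCoeff α j =
      (ascPochhammer ℂ j).eval (α : ℂ) := by
    induction j with
    | zero => simp [negBinomCoeff]
    | succ j ih =>
      rw [ascPochhammer_succ_eval, ← ih, negBinomCoeff, Nat.factorial_succ]
      have : (j : ℂ) + 1 ≠ 0 := by exact_mod_cast Nat.succ_ne_zero j
      push_cast
      field_simp
  exact mul_left_cancel₀ (by exact_mod_cast j.factorial_ne_zero) ((key j).trans (h2 j).symm)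

lemma hasSum_negBinomCoeff (α : ℝ) {z : ℂ} (hz : ‖z‖ < 1) :
    HasSum (fun j => (negBinomCoeff α j : ℂ) * z ^ j) ((1 - z) ^ (-α : ℂ)) := by
  have h := (Complex.one_div_one_sub_cpow_hasFPowerSeriesOnBall_zero (α : ℂ)).hasSum (y := z)
    (by rwa [Metric.mem_eball, edist_zero_right, ← ofReal_norm, ENNReal.ofReal_lt_one])
  simp only [FormalMultilinearSeries.ofScalars_apply_eq, zero_add, ringChoose_eq_negBinomCoeff,
    smul_eq_mul, one_div, ← Complex.cpow_neg] at h
  exact h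

lemma summable_negBinomCoeff (hα : 0 < α) {r : ℝ} (h0 : 0 ≤ r) (h1 : r < 1) :
    Summable fun j => negBinomCoeff α j * r ^ j := by
  have h := (hasSum_negBinomCoeff α (z := r)
    (by rwa [Complex.norm_real, Real.norm_of_nonneg h0])).summable.norm
  refine h.congr fun j => ?_
  simp [abs_of_pos (negBinomCoeff_pos hα j), abs_of_nonneg h0]

lemma hasSum_mul_prod {u v : ℕ → ℂ} {a b : ℂ} (hu : HasSum u a) (hv : HasSum v b) :
    HasSum (fun x : ℕ × ℕ => u x.1 * v x.2) (a * b) := by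
  have hs : Summable fun x : ℕ × ℕ => u x.1 * v x.2 :=
    summable_mul_of_summable_norm (f := u) (g := v) hu.summable.norm hv.summable.norm
  exact HasSum.mul hu hv hs

/-- The kernel is (1-z)^(-α) times its conjugate, and the two binomial series are multiplied. -/
lemma hasSum_kernel (α : ℝ) {z : ℂ} (hz : ‖z‖ < 1) :
    HasSum (fun x : ℕ × ℕ => ((negBinomCoeff α x.1 * negBinomCoeff α x.2 : ℝ) : ℂ) *
      (z ^ x.1 * star z ^ x.2)) ((‖1 - z‖ ^ (-(2 * α)) : ℝ) : ℂ) := by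
  have h1 := hasSum_negBinomCoeff α hz
  have h2 : HasSum (fun j => (negBinomCoeff α j : ℂ) * star z ^ j)
      (star ((1 - z) ^ (-α : ℂ))) := by
    have := h1.star
    simp only [star_mul', star_pow, RCLike.star_def, Complex.conj_ofReal] at this ⊢
    exact this
  have h3 := hasSum_mul_prod h1 h2
  have e : (1 - z) ^ (-α : ℂ) * star ((1 - z) ^ (-α : ℂ)) = ((‖1 - z‖ ^ (-(2 * α)) : ℝ) : ℂ) := by
    rw [RCLike.star_def, Complex.mul_conj, Complex.normSq_eq_norm_sq, ← Complex.ofReal_neg,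
      Complex.norm_cpow_real, ← Real.rpow_mul_natCast (norm_nonneg _)]
    congr 2
    push_cast
    ring
  have hfun : (fun x : ℕ × ℕ => ((negBinomCoeff α x.1 * negBinomCoeff α x.2 : ℝ) : ℂ) *
      (z ^ x.1 * star z ^ x.2)) = fun x => (negBinomCoeff α x.1 : ℂ) * z ^ x.1 *
        ((negBinomCoeff α x.2 : ℂ) * star z ^ x.2) := by
    funext x
    push_cast
    ring
  rw [hfun, ← e]
  exact h3

end BinomialSeries

/-! ### Abel summation with nonnegative terms. -/

section Abel

open Filter Topology

/-- Abel summation for series with nonnegative terms. -/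
lemma hasSum_of_abel {κ : Type*} {a : κ → ℝ} (ha : ∀ i, 0 ≤ a i) (e : κ → ℕ) {b : ℝ → ℝ} {B : ℝ}
    (h : ∀ r ∈ Set.Ioo (0 : ℝ) 1, HasSum (fun i => r ^ e i * a i) (b r))
    (hb : Tendsto b (𝓝[<] 1) (𝓝 B)) : HasSum a B := by
  have hev : ∀ᶠ r : ℝ in 𝓝[<] 1, r ∈ Set.Ioo (0 : ℝ) 1 := Ioo_mem_nhdsLT one_pos
  -- Finite partial sums at r lie below b r; letting r → 1 bounds those of a by B. This gives
  -- summability, after which b r ≤ ∑ a supplies the reverse inequality.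
  have hle (T : Finset κ) : ∑ i ∈ T, a i ≤ B := by
    have h1 : Tendsto (fun r : ℝ => ∑ i ∈ T, r ^ e i * a i) (𝓝[<] 1)
        (𝓝 (∑ i ∈ T, (1 : ℝ) ^ e i * a i)) :=
      (Continuous.tendsto (by fun_prop) 1).mono_left nhdsWithin_le_nhds
    simp only [one_pow, one_mul] at h1
    refine le_of_tendsto_of_tendsto h1 hb ?_
    filter_upwards [hev] with r hr
    exact sum_le_hasSum T (fun i _ => mul_nonneg (pow_nonneg hr.1.le _) (ha i)) (h r hr)
  have hs : Summable a := summable_of_sum_le ha hle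
  have h1 : ∑' i, a i ≤ B := hs.tsum_le_of_sum_le hle
  have h2 : B ≤ ∑' i, a i := by
    refine le_of_tendsto hb ?_
    filter_upwards [hev] with r hr
    refine hasSum_le (fun i => ?_) (h r hr) hs.hasSum
    exact mul_le_of_le_one_left (ha i) (pow_le_one₀ hr.1.le hr.2.le)
  rw [le_antisymm h2 h1]
  exact hs.hasSum

end Abel

/-! ### The singular kernel and the passage r → 1. -/

section Kernel

variable {n : ℕ}

-- The cone over a point lies in a real line, a proper subspace and hence a null set.
open scoped Pointwise in
lemma sphereMeasure_singleton (ζ : CSphere n) : sphereMeasure n {ζ} = 0 := by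
  have hspan : Submodule.span ℝ {(ζ : CSpace n)} ≠ ⊤ := by
    intro h
    have h1 := finrank_span_singleton (K := ℝ) (v := (ζ : CSpace n))
      (ne_zero_of_mem_unit_sphere ζ)
    rw [h, finrank_top, ← Module.finrank_mul_finrank ℝ ℂ, Complex.finrank_real_complex] at h1
    omega
  have h0 := Measure.addHaar_submodule (volume : Measure (CSpace n)) _ hspan
  rw [sphereMeasure, Measure.toSphere_apply' _ (measurableSet_singleton _)]
  have hsub : Set.Ioo (0 : ℝ) 1 • ((↑) '' ({ζ} : Set (CSphere n)) : Set (CSpace n)) ⊆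
      (Submodule.span ℝ {(ζ : CSpace n)} : Set (CSpace n)) := by
    rintro _ ⟨r, _, _, ⟨η, hη, rfl⟩, rfl⟩
    rw [Set.mem_singleton_iff.1 hη]
    exact Submodule.smul_mem _ _ (Submodule.mem_span_singleton_self _)
  rw [measure_mono_null hsub h0, mul_zero]

lemma eq_of_hdot_eq_one {ζ η : CSphere n} (h : hdot ζ η = 1) : η = ζ := by
  rw [hdot_eq_inner, inner_eq_one_iff_of_norm_eq_one (by simp) (by simp)] at h
  exact Subtype.ext h

lemma ae_hdot_ne_one :
    ∀ᵐ z : CSphere n × CSphere n ∂(sphereMeasure n).prod (sphereMeasure n), hdot z.1 z.2 ≠ 1 := by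
  have hm : MeasurableSet {z : CSphere n × CSphere n | hdot z.1 z.2 = 1} :=
    (isClosed_singleton.preimage continuous_hdot).measurableSet
  rw [ae_iff]
  simp only [ne_eq, not_not]
  rw [Measure.measure_prod_null hm]
  refine .of_forall fun ζ => ?_
  exact measure_mono_null (fun η hη => eq_of_hdot_eq_one hη) (sphereMeasure_singleton ζ)

/-- Both |1-w| ≤ |1-rw| + (1-r) and 1-r ≤ |1-rw| hold, so |1-w| ≤ 2 |1-rw|. This supplies the
dominating function as r → 1, and at r = 0 a positive lower bound for the kernel. -/
lemma rpow_norm_one_sub_le {α : ℝ} (hα : 0 < α) {w : ℂ} (hw : ‖w‖ ≤ 1) (hw1 : w ≠ 1) {r : ℝ}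
    (h0 : 0 ≤ r) (h1 : r ≤ 1) :
    ‖1 - r * w‖ ^ (-(2 * α)) ≤ 2 ^ (2 * α) * ‖1 - w‖ ^ (-(2 * α)) := by
  have hpos : 0 < ‖1 - w‖ := norm_pos_iff.2 (sub_ne_zero.2 hw1.symm)
  have h2 : ‖1 - w‖ / 2 ≤ ‖1 - r * w‖ := by
    have e : 1 - w = (1 - r * w) - ((1 - r : ℝ) : ℂ) * w := by push_cast; ring
    have h3 : ‖1 - w‖ ≤ ‖1 - r * w‖ + (1 - r) := by
      rw [e]
      refine (norm_sub_le _ _).trans ?_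
      rw [norm_mul, Complex.norm_real, Real.norm_of_nonneg (by linarith)]
      have := mul_le_of_le_one_right (sub_nonneg.2 h1) hw
      linarith
    have h4 : 1 - r ≤ ‖1 - r * w‖ := by
      have := norm_sub_norm_le (1 : ℂ) (r * w)
      rw [norm_one, norm_mul, Complex.norm_real, Real.norm_of_nonneg h0] at this
      have := mul_le_of_le_one_right h0 hw
      linarith
    linarith
  refine (Real.rpow_le_rpow_of_nonpos (by positivity) h2 (by linarith)).trans_eq ?_
  rw [Real.div_rpow hpos.le zero_le_two, Real.rpow_neg zero_le_two, div_inv_eq_mul, mul_comm]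

variable {α : ℝ} {f : CSphere n → ℂ}

lemma integrable_mul_of_converges (hα : 0 < α) (hfm : AEStronglyMeasurable f (sphereMeasure n))
    (hf : QuadFormConverges (fun ζ η => (rieszKernel α ζ η : ℂ)) f) :
    Integrable (fun z : CSphere n × CSphere n => star (f z.1) * f z.2)
      ((sphereMeasure n).prod (sphereMeasure n)) := by
  have hm : AEStronglyMeasurable (fun z : CSphere n × CSphere n => star (f z.1) * f z.2)
      ((sphereMeasure n).prod (sphereMeasure n)) :=
    (continuous_star.comp_aestronglyMeasurable hfm.comp_fst).mul hfm.comp_snd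
  refine (hf.norm.const_mul (2 ^ (2 * α))).mono' hm ?_
  filter_upwards [ae_hdot_ne_one] with z hz
  have h := rpow_norm_one_sub_le hα (norm_hdot_le_one z.1 z.2) hz le_rfl zero_le_one
  simp only [Complex.ofReal_zero, zero_mul, sub_zero, norm_one, Real.one_rpow] at h
  rw [norm_mul, norm_mul, norm_mul, rieszKernel, Complex.norm_real,
    Real.norm_of_nonneg (by positivity)]
  calc ‖star (f z.1)‖ * ‖f z.2‖ = 1 * (‖star (f z.1)‖ * ‖f z.2‖) := (one_mul _).symm
    _ ≤ (2 ^ (2 * α) * ‖1 - hdot z.1 z.2‖ ^ (-(2 * α))) * (‖star (f z.1)‖ * ‖f z.2‖) := by gcongr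
    _ = _ := by ring

/-- The kernel is bounded below, so conj (f ζ) * f η is integrable on the product. By Fubini almost
every slice is integrable, and a slice with f ζ ≠ 0 is a nonzero multiple of f. -/
lemma integrable_of_converges (hα : 0 < α) (hfm : AEStronglyMeasurable f (sphereMeasure n))
    (hf : QuadFormConverges (fun ζ η => (rieszKernel α ζ η : ℂ)) f) :
    Integrable f (sphereMeasure n) := by
  by_cases h0 : f =ᵐ[sphereMeasure n] 0
  · exact (integrable_zero _ _ _).congr h0.symm
  have h1 := (integrable_mul_of_converges hα hfm hf).prod_right_ae
  have h2 : ∃ᶠ ζ in ae (sphereMeasure n), f ζ ≠ 0 := Filter.not_eventually.1 h0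
  obtain ⟨ζ, hζ, hi⟩ := (h2.and_eventually h1).exists
  exact (integrable_const_mul_iff (star_ne_zero.2 hζ).isUnit _).1 hi

lemma measurable_dilatedKernel (α r : ℝ) : Measurable fun z : CSphere n × CSphere n =>
    ((‖1 - r * hdot z.1 z.2‖ ^ (-(2 * α)) : ℝ) : ℂ) := by
  have : Continuous fun z : CSphere n × CSphere n => ‖1 - r * hdot z.1 z.2‖ := by
    have := continuous_hdot (n := n)
    fun_prop
  exact Complex.measurable_ofReal.comp (this.measurable.pow_const _)

open Filter Topology in
/-- The quadratic form of the Riesz kernel times a bounded factor `b`, as a series of moments. -/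
lemma hasSum_quadForm (hα : 0 < α) (hfm : AEStronglyMeasurable f (sphereMeasure n))
    (hf : QuadFormConverges (fun ζ η => (rieszKernel α ζ η : ℂ)) f)
    {b : CSphere n → CSphere n → ℂ} (hb : Continuous fun z : CSphere n × CSphere n => b z.1 z.2)
    {C : ℝ} (hC : ∀ ζ η, ‖b ζ η‖ ≤ C) {Q : ℕ → ℕ → ℝ} (hQ0 : ∀ j k, 0 ≤ Q j k)
    (hQ : ∀ j k, quadForm (fun ζ η => b ζ η * (hdot ζ η ^ j * star (hdot ζ η) ^ k)) f = Q j k) :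
    ∃ B : ℝ, quadForm (fun ζ η => b ζ η * (rieszKernel α ζ η : ℂ)) f = B ∧
      HasSum (fun x : ℕ × ℕ => negBinomCoeff α x.1 * negBinomCoeff α x.2 * Q x.1 x.2) B := by
  set μ := (sphereMeasure n).prod (sphereMeasure n)
  have hff : Integrable (fun z : CSphere n × CSphere n => star (f z.1) * f z.2) μ :=
    integrable_mul_of_converges hα hfm hf
  have hw : Continuous fun z : CSphere n × CSphere n => hdot z.1 z.2 := continuous_hdot
  -- The form with w replaced by rw in the kernel: for r < 1 the double series converges absolutely,
  -- uniformly in w, and can be integrated term by term.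
  let Z (r : ℝ) : ℂ := ∫ z : CSphere n × CSphere n,
    star (f z.1) * (b z.1 z.2 * ((‖1 - r * hdot z.1 z.2‖ ^ (-(2 * α)) : ℝ) : ℂ)) * f z.2 ∂μ
  have hZ (r : ℝ) (hr : r ∈ Set.Ioo (0 : ℝ) 1) :
      HasSum (fun x : ℕ × ℕ => ((r ^ (x.1 + x.2) *
        (negBinomCoeff α x.1 * negBinomCoeff α x.2 * Q x.1 x.2) : ℝ) : ℂ)) (Z r) := by
    let cc (x : ℕ × ℕ) : ℝ := r ^ (x.1 + x.2) * (negBinomCoeff α x.1 * negBinomCoeff α x.2)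
    have hcc (x) : 0 ≤ cc x := mul_nonneg (pow_nonneg hr.1.le _)
      (mul_nonneg (negBinomCoeff_pos hα _).le (negBinomCoeff_pos hα _).le)
    let F (x : ℕ × ℕ) (z : CSphere n × CSphere n) : ℂ := cc x *
      (star (f z.1) * (b z.1 z.2 * (hdot z.1 z.2 ^ x.1 * star (hdot z.1 z.2) ^ x.2)) * f z.2)
    have hle (x : ℕ × ℕ) (z : CSphere n × CSphere n) :
        ‖b z.1 z.2 * (hdot z.1 z.2 ^ x.1 * star (hdot z.1 z.2) ^ x.2)‖ ≤ C := by
      rw [norm_mul, norm_mul, norm_pow, norm_pow, norm_star, ← pow_add]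
      exact (mul_le_of_le_one_right (norm_nonneg _)
        (pow_le_one₀ (norm_nonneg _) (norm_hdot_le_one _ _))).trans (hC _ _)
    have hFi (x : ℕ × ℕ) : Integrable (F x) μ := by
      refine Integrable.const_mul ?_ _
      have := hff.bdd_mul (c := C) (f := fun z : CSphere n × CSphere n =>
        b z.1 z.2 * (hdot z.1 z.2 ^ x.1 * star (hdot z.1 z.2) ^ x.2))
        (Continuous.aestronglyMeasurable (by fun_prop)) (.of_forall (hle x))
      exact this.congr (.of_forall fun z => by ring)
    have hFle (x : ℕ × ℕ) (z : CSphere n × CSphere n) :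
        ‖F x z‖ ≤ cc x * (C * ‖star (f z.1) * f z.2‖) := by
      have e : F x z = cc x *
          ((b z.1 z.2 * (hdot z.1 z.2 ^ x.1 * star (hdot z.1 z.2) ^ x.2)) *
            (star (f z.1) * f z.2)) := by simp only [F]; ring
      rw [e, norm_mul, norm_mul (_ * _) (star _ * _), Complex.norm_real, Real.norm_of_nonneg (hcc x)]
      exact mul_le_mul_of_nonneg_left
        (mul_le_mul_of_nonneg_right (hle x z) (norm_nonneg _)) (hcc x)
    have hccs : Summable cc := by
      have h1 := summable_negBinomCoeff hα hr.1.le hr.2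
      have h2 := h1.mul_of_nonneg h1
        (fun j => mul_nonneg (negBinomCoeff_pos hα j).le (pow_nonneg hr.1.le _))
        (fun j => mul_nonneg (negBinomCoeff_pos hα j).le (pow_nonneg hr.1.le _))
      refine h2.congr fun x => ?_
      simp only [cc, pow_add]
      ring
    have hs : Summable fun x => ∫ z, ‖F x z‖ ∂μ := by
      refine Summable.of_nonneg_of_le (fun x => integral_nonneg fun _ => norm_nonneg _)
        (fun x => integral_mono (hFi x).norm ((hff.norm.const_mul C).const_mul _) (hFle x)) ?_
      simp only [integral_const_mul]
      exact hccs.mul_right _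
    have key := hasSum_integral_of_summable_integral_norm hFi hs
    have e1 : ∫ z, ∑' x, F x z ∂μ = Z r := by
      refine integral_congr_ae (.of_forall fun z => ?_)
      have hz : ‖(r : ℂ) * hdot z.1 z.2‖ < 1 := by
        rw [norm_mul, Complex.norm_real, Real.norm_of_nonneg hr.1.le]
        exact (mul_le_of_le_one_right hr.1.le (norm_hdot_le_one _ _)).trans_lt hr.2
      have h1 := ((hasSum_kernel α hz).mul_left (star (f z.1) * b z.1 z.2)).mul_right (f z.2)
      refine (Eq.trans (tsum_congr fun x => ?_) h1.tsum_eq).trans (by ring)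
      simp only [F, cc, star_mul', mul_pow, RCLike.star_def, Complex.conj_ofReal, pow_add]
      push_cast
      ring
    rw [e1] at key
    have hfun : (fun x => ∫ z, F x z ∂μ) = fun x => ((r ^ (x.1 + x.2) *
        (negBinomCoeff α x.1 * negBinomCoeff α x.2 * Q x.1 x.2) : ℝ) : ℂ) := by
      funext x
      have := hQ x.1 x.2
      unfold quadForm at this
      simp only [F, cc]
      rw [integral_const_mul, this]
      push_cast
      ring
    rwa [hfun] at key
  have hlim : Tendsto Z (𝓝[<] 1)
      (𝓝 (quadForm (fun ζ η => b ζ η * (rieszKernel α ζ η : ℂ)) f)) := by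
    refine tendsto_integral_filter_of_dominated_convergence
      (fun z => C * (2 ^ (2 * α) * ‖star (f z.1) * (rieszKernel α z.1 z.2 : ℂ) * f z.2‖)) ?_ ?_ ?_ ?_
    · refine .of_forall fun r => ?_
      exact ((continuous_star.comp_aestronglyMeasurable hfm.comp_fst).mul
        (hb.aestronglyMeasurable.mul (measurable_dilatedKernel α r).aestronglyMeasurable)).mul
        hfm.comp_snd
    · filter_upwards [Ioo_mem_nhdsLT one_pos] with r hr
      filter_upwards [ae_hdot_ne_one] with z hz
      have h := rpow_norm_one_sub_le hα (norm_hdot_le_one z.1 z.2) hz hr.1.le hr.2.le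
      simp only [norm_mul, rieszKernel, Complex.norm_real]
      rw [Real.norm_of_nonneg (by positivity), Real.norm_of_nonneg (by positivity)]
      have hC0 : 0 ≤ C := (norm_nonneg _).trans (hC z.1 z.2)
      calc ‖star (f z.1)‖ * (‖b z.1 z.2‖ * ‖1 - r * hdot z.1 z.2‖ ^ (-(2 * α))) * ‖f z.2‖
          ≤ ‖star (f z.1)‖ * (C * (2 ^ (2 * α) * ‖1 - hdot z.1 z.2‖ ^ (-(2 * α)))) * ‖f z.2‖ := by
            gcongr
            exact hC _ _
        _ = _ := by ring
    · exact (hf.norm.const_mul _).const_mul _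
    · filter_upwards [ae_hdot_ne_one] with z hz
      have hne : ‖1 - ((1 : ℝ) : ℂ) * hdot z.1 z.2‖ ≠ 0 := by
        rw [Complex.ofReal_one, one_mul, norm_ne_zero_iff, sub_ne_zero]
        exact hz.symm
      have h1 : Tendsto (fun r : ℝ => ‖1 - (r : ℂ) * hdot z.1 z.2‖) (𝓝[<] 1)
          (𝓝 ‖1 - ((1 : ℝ) : ℂ) * hdot z.1 z.2‖) :=
        (Continuous.tendsto (by fun_prop) 1).mono_left nhdsWithin_le_nhds
      have h2 := h1.rpow_const (p := -(2 * α)) (Or.inl hne)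
      have h3 := (Complex.continuous_ofReal.tendsto _).comp h2
      have h4 := ((h3.const_mul (b z.1 z.2)).const_mul (star (f z.1))).mul_const (f z.2)
      simpa [rieszKernel, Function.comp_def] using h4
  have him (r : ℝ) (hr : r ∈ Set.Ioo (0 : ℝ) 1) : (Z r).im = 0 := by
    have := Complex.imCLM.hasSum (hZ r hr)
    simp only [Complex.imCLM_apply, Complex.ofReal_im] at this
    exact this.unique hasSum_zero
  have him' : (quadForm (fun ζ η => b ζ η * (rieszKernel α ζ η : ℂ)) f).im = 0 := by
    refine tendsto_nhds_unique ((Complex.continuous_im.tendsto _).comp hlim)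
      (tendsto_const_nhds.congr' ?_)
    filter_upwards [Ioo_mem_nhdsLT one_pos] with r hr
    exact (him r hr).symm
  refine ⟨(quadForm (fun ζ η => b ζ η * (rieszKernel α ζ η : ℂ)) f).re,
    Complex.ext rfl (by simpa using him'), ?_⟩
  refine hasSum_of_abel (fun x => mul_nonneg (mul_nonneg (negBinomCoeff_pos hα _).le
    (negBinomCoeff_pos hα _).le) (hQ0 _ _)) (fun x => x.1 + x.2) (b := fun r => (Z r).re) ?_
    ((Complex.continuous_re.tendsto _).comp hlim)
  intro r hr
  have := Complex.reCLM.hasSum (hZ r hr)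
  simpa only [Function.comp_def, Complex.reCLM_apply, Complex.ofReal_re] using this

lemma zonalMoment_nonneg (f : CSphere n → ℂ) (p q : ℕ) : 0 ≤ zonalMoment f p q :=
  Finset.sum_nonneg fun k _ => mul_nonneg (by unfold zonalCoeff; positivity)
    (harmonicEnergy_nonneg f _ _)

lemma quadForm_add_star_mul_pow (hf : Integrable f (sphereMeasure n)) (j k : ℕ) :
    quadForm (fun ζ η => (hdot ζ η + star (hdot ζ η)) * (hdot ζ η ^ j * star (hdot ζ η) ^ k)) f =
      ((zonalMoment f (j + 1) k + zonalMoment f j (k + 1) : ℝ) : ℂ) := by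
  have hw := continuous_hdot (n := n)
  have hff : Integrable (fun z : CSphere n × CSphere n => star (f z.1) * f z.2)
      ((sphereMeasure n).prod (sphereMeasure n)) :=
    Integrable.mul_prod (Complex.conjCLE.toContinuousLinearMap.integrable_comp hf) hf
  have hI (p q : ℕ) : Integrable (fun z : CSphere n × CSphere n =>
      star (f z.1) * (hdot z.1 z.2 ^ p * star (hdot z.1 z.2) ^ q) * f z.2)
      ((sphereMeasure n).prod (sphereMeasure n)) := by
    have := hff.bdd_mul (c := 1) (f := fun z : CSphere n × CSphere n =>
      hdot z.1 z.2 ^ p * star (hdot z.1 z.2) ^ q)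
      (Continuous.aestronglyMeasurable (by fun_prop)) (.of_forall fun z => by
        rw [norm_mul, norm_pow, norm_pow, norm_star, ← pow_add]
        exact pow_le_one₀ (norm_nonneg _) (norm_hdot_le_one _ _))
    exact this.congr (.of_forall fun z => by ring)
  rw [Complex.ofReal_add, ← quadForm_hdot_pow hf, ← quadForm_hdot_pow hf]
  unfold quadForm
  rw [← integral_add (hI _ _) (hI _ _)]
  exact integral_congr_ae (.of_forall fun z => by ring)

/-- The factor w + w̄ raises one exponent of the moment, and reindexing moves the shift to the
coefficients, using `shiftedCoeff α 0 = 0`. Nonnegativity permits splitting the sum in two. -/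
lemma hasSum_shift (hα : 0 < α) {M : ℕ → ℕ → ℝ} (hM : ∀ j k, 0 ≤ M j k) {A : ℝ}
    (h : HasSum (fun x : ℕ × ℕ => negBinomCoeff α x.1 * negBinomCoeff α x.2 *
      (M (x.1 + 1) x.2 + M x.1 (x.2 + 1))) A) :
    HasSum (fun x : ℕ × ℕ => (shiftedCoeff α x.1 * negBinomCoeff α x.2 +
      negBinomCoeff α x.1 * shiftedCoeff α x.2) * M x.1 x.2) A := by
  have hc (x : ℕ × ℕ) : 0 ≤ negBinomCoeff α x.1 * negBinomCoeff α x.2 :=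
    mul_nonneg (negBinomCoeff_pos hα _).le (negBinomCoeff_pos hα _).le
  have h1 : Summable fun x : ℕ × ℕ => negBinomCoeff α x.1 * negBinomCoeff α x.2 *
      M (x.1 + 1) x.2 :=
    h.summable.of_nonneg_of_le (fun x => mul_nonneg (hc x) (hM _ _)) fun x =>
      mul_le_mul_of_nonneg_left (le_add_of_nonneg_right (hM _ _)) (hc x)
  have h2 : Summable fun x : ℕ × ℕ => negBinomCoeff α x.1 * negBinomCoeff α x.2 *
      M x.1 (x.2 + 1) :=
    h.summable.of_nonneg_of_le (fun x => mul_nonneg (hc x) (hM _ _)) fun x =>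
      mul_le_mul_of_nonneg_left (le_add_of_nonneg_left (hM _ _)) (hc x)
  have h3 : HasSum (fun x : ℕ × ℕ => shiftedCoeff α x.1 * negBinomCoeff α x.2 * M x.1 x.2)
      (∑' x : ℕ × ℕ, negBinomCoeff α x.1 * negBinomCoeff α x.2 * M (x.1 + 1) x.2) := by
    refine (Function.Injective.hasSum_iff (g := fun x : ℕ × ℕ => (x.1 + 1, x.2))
      (fun x y hxy => by simpa [Prod.ext_iff] using hxy) ?_).1 h1.hasSum
    rintro ⟨_ | j, k⟩ hx
    · simp [shiftedCoeff]
    · exact absurd ⟨(j, k), rfl⟩ hx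
  have h4 : HasSum (fun x : ℕ × ℕ => negBinomCoeff α x.1 * shiftedCoeff α x.2 * M x.1 x.2)
      (∑' x : ℕ × ℕ, negBinomCoeff α x.1 * negBinomCoeff α x.2 * M x.1 (x.2 + 1)) := by
    refine (Function.Injective.hasSum_iff (g := fun x : ℕ × ℕ => (x.1, x.2 + 1))
      (fun x y hxy => by simpa [Prod.ext_iff] using hxy) ?_).1 h2.hasSum
    rintro ⟨j, _ | k⟩ hx
    · simp [shiftedCoeff]
    · exact absurd ⟨(j, k), rfl⟩ hx
  have hA := (h1.hasSum.add h2.hasSum).unique (by simpa only [mul_add] using h)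
  rw [← hA]
  simpa only [add_mul] using h3.add h4

end Kernel

/-! ### The main theorem. -/

theorem theorem4p1 (n : ℕ) (hn : 1 ≤ n) (α : ℝ) (hα0 : 0 < α) (hα1 : α < ((n : ℝ) + 1) / 2)
    (f : CSphere n → ℂ) (hfm : AEStronglyMeasurable f (sphereMeasure n))
    (hf : QuadFormConverges (fun ζ η => (rieszKernel α ζ η : ℂ)) f) :
    QuadFormConverges (fun ζ η => (hdot ζ η + star (hdot ζ η)) * (rieszKernel α ζ η : ℂ)) f ∧
    (quadForm (fun ζ η => (hdot ζ η + star (hdot ζ η)) * (rieszKernel α ζ η : ℂ)) f).im = 0 ∧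
    (quadForm (fun ζ η => (rieszKernel α ζ η : ℂ)) f).im = 0 ∧
    2 * α / ((n : ℝ) + 1 - α) * (quadForm (fun ζ η => (rieszKernel α ζ η : ℂ)) f).re ≤
      (quadForm (fun ζ η => (hdot ζ η + star (hdot ζ η)) * (rieszKernel α ζ η : ℂ)) f).re ∧
    ((quadForm (fun ζ η => (hdot ζ η + star (hdot ζ η)) * (rieszKernel α ζ η : ℂ)) f).re =
        2 * α / ((n : ℝ) + 1 - α) * (quadForm (fun ζ η => (rieszKernel α ζ η : ℂ)) f).re ↔
      ∃ c : ℂ, ∀ᵐ ζ ∂(sphereMeasure n), f ζ = c) := by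
  have hfi := integrable_of_converges hα0 hfm hf
  have hw := continuous_hdot (n := n)
  have hwle (ζ η : CSphere n) : ‖hdot ζ η + star (hdot ζ η)‖ ≤ 2 := by
    refine (norm_add_le _ _).trans ?_
    rw [norm_star]
    linarith [norm_hdot_le_one ζ η]
  have hM := zonalMoment_nonneg f
  obtain ⟨B, hB, hsB⟩ := hasSum_quadForm hα0 hfm hf (b := fun _ _ => 1) continuous_const
    (C := 1) (fun _ _ => by simp) hM (fun j k => by
      simp only [one_mul]; exact quadForm_hdot_pow hfi j k)
  obtain ⟨A, hA, hsA⟩ := hasSum_quadForm hα0 hfm hf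
    (b := fun ζ η => hdot ζ η + star (hdot ζ η)) (by fun_prop) hwle
    (fun j k => add_nonneg (hM (j + 1) k) (hM j (k + 1)))
    (fun j k => quadForm_add_star_mul_pow hfi j k)
  simp only [one_mul] at hB
  obtain ⟨hle, hiff⟩ := energy_comparison (n := n) hα0 (by linarith) (harmonicEnergy_nonneg f)
    (fun _ _ => rfl) hsB (hasSum_shift hα0 hM hsA)
  rw [hA, hB]
  refine ⟨?_, Complex.ofReal_im _, Complex.ofReal_im _, hle, hiff.trans ⟨fun h =>
    ae_const_of_harmonicEnergy_eq_zero hfi h, ?_⟩⟩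
  · have := Integrable.bdd_mul (c := 2) (f := fun z : CSphere n × CSphere n =>
      hdot z.1 z.2 + star (hdot z.1 z.2)) hf (Continuous.aestronglyMeasurable (by fun_prop))
      (.of_forall fun z => hwle _ _)
    exact this.congr (.of_forall fun z => by ring)
  · rintro ⟨c, hc⟩ p q hpq
    -- Energies depend on f only up to null sets, so those of f equal those of the constant c.
    rw [← harmonicEnergy_const (n := n) c hpq]
    simp only [harmonicEnergy, harmonicMoment]
    congr 1
    refine Finset.sum_congr rfl fun s _ => ?_
    congr 3
    exact integral_congr_ae (hc.mono fun η hη => by simp only [hη])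

end
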